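/- Let $k$ be a field; all algebras and coalgebras are over $k$, algebras are unital and associative, coalgebras are counital and coassociative, and $\otimes=\otimes_k$. **Hopf algebroids.** A left bialgebroid consists of algebras $A$ and $U$; algebra maps $s:A\to U$ and $t:A^{op}\to U$ with commuting images, making $U$ an $(A,A)$-bimodule by $a\cdot u\cdot b=s(a)t(b)u$; and a coalgebra $(U,\Delta:U\to U\otimes_AU,\ \epsilon:U\to A)$ in the monoidal category of $(A,A)$-bimodules, such that $\Delta$ is a unital algebra map into the Takeuchi product $U\times_AU=\{\sum u_i\otimes u_i'\in U\otimes_A U:\ \sum u_it(a)\otimes u_i'=\sum u_i\otimes u_i's(a)\ \forall a\in A\}$ and $\epsilon(us(\epsilon(u')))=\epsilon(uu')=\epsilon(ut(\epsilon(u')))$. A Hopf algebroid $\mathcal U=(U,A,s,t,\Delta,\epsilon,S)$ is a left bialgebroid with an anti-automorphism $S$ of the algebra $U$ with $S^2=\mathrm{id}$, $St=s$ and, in $U\otimes_AU$, $$S(u_{(1)})_{(1)}u_{(2)}\otimes S(u_{(1)})_{(2)}=1\otimes S(u),\qquad S(u_{(2)})_{(1)}\otimes S(u_{(2)})_{(2)}u_{(1)}=S(u)\otimes1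 .$$ A morphism $\mathcal U\to\mathcal U'$ is a pair of algebra maps $F:U\to U'$, $f:A\to A'$ with $Fs=s'f$, $Ft=t'f$, $\Delta'F=(F\otimes_fF)\Delta$, $f\epsilon=\epsilon'F$ and $S'F=FS$. Let $HAlg_k$ be the category of Hopf algebroids. **Measurings.** Let $V(\mathcal U,\mathcal U')\subseteq \mathrm{Hom}_k(U,U')\times\mathrm{Hom}_k(A,A')$ be the subspace of the pairs $(F,f)$ of linear maps with $Fs=s'f$, $Ft=t'f$, $FS=S'F$, $f\epsilon=\epsilon'F$. A measuring from $\mathcal U$ to $\mathcal U'$ by a cocommutative coalgebra $C$ is a linear map $(\Psi,\psi):C\to V(\mathcal U,\mathcal U')$ such that $\Psi(x)(uv)=\Psi(x_{(1)})(u)\Psi(x_{(2)})(v)$, $\Psi(x)(1)=\epsilon_C(x)1$, similarly for $\psi$, and $\Delta'(\Psi(x)(u))=\Psi(x_{(1)})(u_{(1)})\otimes\Psi(x_{(2)})(u_{(2)})$ in $U'\otimes_{A'}U'$, for all $x\in C$. The cofree coalgebra on a vector space $V$ is a coalgebra $\mathfrak C(V)$ with a linear map $\pi(V):\mathfrak C(V)\to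 V$ through which every linear map from a coalgebra to $V$ factors by a unique coalgebra map. **Theorem.** Every vector space has a cofree coalgebra. For Hopf algebroids $\mathcal U,\mathcal U'$ let $\mathcal M_c(\mathcal U,\mathcal U')$ be the sum of all cocommutative subcoalgebras $D$ of $\mathfrak C(V(\mathcal U,\mathcal U'))$ such that $\pi(V(\mathcal U,\mathcal U'))|_D$ is a measuring, and let $(\Phi,\phi)$ be the restriction of $\pi(V(\mathcal U,\mathcal U'))$ to it. 1. $\mathcal M_c(\mathcal U,\mathcal U')$ is a cocommutative coalgebra, $(\Phi,\phi)$ is a measuring from $\mathcal U$ to $\mathcal U'$, and for every measuring $(\Psi,\psi)$ from $\mathcal U$ to $\mathcal U'$ by a cocommutative coalgebra $C$ there is a unique morphism of coalgebras $\xi:C\to\mathcal M_c(\mathcal U,\mathcal U')$ with $(\Phi,\phi)\circ\xi=(\Psi,\psi)$. 2. The maps $\mathcal M_c(\mathcal U,\mathcal U')\otimes\mathcal M_c(\mathcal U',\mathcal U'')\to V(\mathcal U,\mathcal U'')$, $x\otimes y\mapsto(\Phi(y)\circ\Phi(x),\phi(y)\circ\phi(x))$, and $k\to V(\mathcal U,\mathcal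 U)$, $c\mapsto(c\cdot\mathrm{id}_U,c\cdot\mathrm{id}_A)$, are measurings. 3. The category $HAlg_k$ is enriched over the symmetric monoidal category $CoCoalg_k$ of cocommutative coalgebras: the hom-objects are the $\mathcal M_c(\mathcal U,\mathcal U')$, composition $\mathcal M_c(\mathcal U,\mathcal U')\otimes\mathcal M_c(\mathcal U',\mathcal U'')\to\mathcal M_c(\mathcal U,\mathcal U'')$ and units $k\to\mathcal M_c(\mathcal U,\mathcal U)$ are the coalgebra maps that the universal property in 1 assigns to the measurings in 2, and the underlying ordinary category is $HAlg_k$, a morphism $(F,f):\mathcal U\to\mathcal U'$ corresponding to the coalgebra map $k\to\mathcal M_c(\mathcal U,\mathcal U')$ assigned to the measuring $c\mapsto(c\cdot F,c\cdot f)$. -/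

import Mathlib

open CategoryTheory MonoidalCategory MulOpposite
open scoped TensorProduct

universe u

/-! ### Left bialgebroids -/

/-- An `(s,t)`-ring over `A`: unital algebra maps `s : A → U` and `t : Aᵒᵖ → U` whose images
commute. It makes `U` an `(A,A)`-bimodule by `a · u · b = s a * t b * u`. -/
structure STRing (k A U : Type*) [Field k] [Ring A] [Algebra k A] [Ring U] [Algebra k U] where
  s : A →ₐ[k] U
  t : Aᵐᵒᵖ →ₐ[k] U
  s_mul_t : ∀ a b : A, s a * t (op b) = t (op b) * s a

namespace STRing

variable {k A U : Type*} [Field k] [Ring A] [Algebra k A] [Ring U] [Algebra k U]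
variable {M : Type*} [AddCommGroup M] [Module k M]

/-- The relations `u·a ⊗ v = u ⊗ a·v` defining `U ⊗_A U` as a quotient of `U ⊗ₖ U`. -/
def rel (σ : STRing k A U) : Submodule k (U ⊗[k] U) :=
  Submodule.span k
    {z | ∃ (a : A) (x y : U), z = (σ.t (op a) * x) ⊗ₜ[k] y - x ⊗ₜ[k] (σ.s a * y)}

/-- The tensor product `U ⊗_A U` over the (possibly noncommutative) algebra `A`. -/
abbrev Tens (σ : STRing k A U) : Type _ := (U ⊗[k] U) ⧸ σ.rel

/-- The quotient map `U ⊗ₖ U → U ⊗_A U`. -/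
def cls (σ : STRing k A U) : (U ⊗[k] U) →ₗ[k] σ.Tens := σ.rel.mkQ

theorem cls_surjective (σ : STRing k A U) : Function.Surjective σ.cls :=
  σ.rel.mkQ_surjective

theorem cls_rel (σ : STRing k A U) (a : A) (x y : U) :
    σ.cls ((σ.t (op a) * x) ⊗ₜ[k] y) = σ.cls (x ⊗ₜ[k] (σ.s a * y)) := by
  rw [← sub_eq_zero, ← map_sub]
  exact (Submodule.Quotient.mk_eq_zero _).2 (Submodule.subset_span ⟨a, x, y, rfl⟩)

/-- `A`-balanced maps descend to `U ⊗_A U`. -/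
def lift (σ : STRing k A U) (f : (U ⊗[k] U) →ₗ[k] M)
    (hf : ∀ (a : A) (x y : U), f ((σ.t (op a) * x) ⊗ₜ[k] y) = f (x ⊗ₜ[k] (σ.s a * y))) :
    σ.Tens →ₗ[k] M :=
  σ.rel.liftQ f <| by
    refine Submodule.span_le.2 ?_
    rintro _ ⟨a, x, y, rfl⟩
    simp [hf a x y]

@[simp]
theorem lift_cls (σ : STRing k A U) (f : (U ⊗[k] U) →ₗ[k] M) (hf) (w : U ⊗[k] U) :
    σ.lift f hf (σ.cls w) = f w :=
  rfl

theorem hom_ext (σ : STRing k A U) {f g : σ.Tens →ₗ[k] M}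
    (h : ∀ x y : U, f (σ.cls (x ⊗ₜ[k] y)) = g (σ.cls (x ⊗ₜ[k] y))) : f = g := by
  refine Submodule.linearMap_qext _ (TensorProduct.ext' ?_)
  intro x y
  exact h x y

/-- The bimodule structure of `U ⊗_A U`: `a · (x ⊗ y) · b = s a * x ⊗ t b * y`. -/
def bimod (σ : STRing k A U) (a b : A) : σ.Tens →ₗ[k] σ.Tens :=
  σ.lift (σ.cls ∘ₗ TensorProduct.map (LinearMap.mulLeft k (σ.s a))
      (LinearMap.mulLeft k (σ.t (op b)))) <| by
    intro c x y
    simp only [LinearMap.comp_apply, TensorProduct.map_tmul, LinearMap.mulLeft_apply]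
    rw [← mul_assoc, σ.s_mul_t, mul_assoc, cls_rel, ← mul_assoc, σ.s_mul_t, mul_assoc]

@[simp]
theorem bimod_cls (σ : STRing k A U) (a b : A) (x y : U) :
    σ.bimod a b (σ.cls (x ⊗ₜ[k] y)) = σ.cls ((σ.s a * x) ⊗ₜ[k] (σ.t (op b) * y)) :=
  rfl

/-- The right action of the algebra `U ⊗ₖ U` on `U ⊗_A U`:
`(x ⊗ y) · (v ⊗ w) = x * v ⊗ y * w`. -/
noncomputable def rmul (σ : STRing k A U) : σ.Tens →ₗ[k] (U ⊗[k] U) →ₗ[k] σ.Tens :=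
  σ.lift ((LinearMap.mul k (U ⊗[k] U)).compr₂ σ.cls) <| by
    intro a x y
    refine TensorProduct.ext' fun v w => ?_
    simp only [LinearMap.compr₂_apply, LinearMap.mul_apply',
      Algebra.TensorProduct.tmul_mul_tmul, mul_assoc, cls_rel]

@[simp]
theorem rmul_cls (σ : STRing k A U) (z w : U ⊗[k] U) : σ.rmul (σ.cls z) w = σ.cls (z * w) :=
  rfl

theorem rmul_rmul (σ : STRing k A U) (z : σ.Tens) (w w' : U ⊗[k] U) :
    σ.rmul (σ.rmul z w) w' = σ.rmul z (w * w') := by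
  obtain ⟨z, rfl⟩ := σ.cls_surjective z
  simp [mul_assoc]

/-- The Takeuchi product `U ×_A U ⊆ U ⊗_A U`, consisting of all `∑ uᵢ ⊗ uᵢ'` with
`∑ uᵢ * t a ⊗ uᵢ' = ∑ uᵢ ⊗ uᵢ' * s a` for every `a`. -/
def takeuchi (σ : STRing k A U) : Submodule k σ.Tens where
  carrier := {z | ∀ a : A, σ.rmul z (σ.t (op a) ⊗ₜ[k] 1) = σ.rmul z (1 ⊗ₜ[k] σ.s a)}
  zero_mem' := by simp
  add_mem' := by
    intro x y hx hy a
    simp [hx a, hy a]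
  smul_mem' := by
    intro c x hx a
    simp [hx a]

/-- Left multiplication `(∑ uᵢ ⊗ uᵢ') * (v ⊗ w) = ∑ uᵢ * v ⊗ uᵢ' * w` by an element of the
Takeuchi product. It restricts to the multiplication of the algebra `U ×_A U`. -/
noncomputable def takMul (σ : STRing k A U) (z : σ.takeuchi) : σ.Tens →ₗ[k] σ.Tens :=
  σ.lift (σ.rmul z.1) <| by
    intro a x y
    have h1 : (σ.t (op a) * x) ⊗ₜ[k] y = (σ.t (op a) ⊗ₜ[k] (1 : U)) * (x ⊗ₜ[k] y) := by simp
    have h2 : x ⊗ₜ[k] (σ.s a * y) = ((1 : U) ⊗ₜ[k] σ.s a) * (x ⊗ₜ[k] y) := by simp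
    rw [h1, h2, ← rmul_rmul, ← rmul_rmul, z.2 a]

@[simp]
theorem takMul_cls (σ : STRing k A U) (z : σ.takeuchi) (w : U ⊗[k] U) :
    σ.takMul z (σ.cls w) = σ.rmul z.1 w :=
  rfl

/-- The relations defining `U ⊗_A U ⊗_A U` as a quotient of `U ⊗ₖ U ⊗ₖ U`. -/
def rel₃ (σ : STRing k A U) : Submodule k (U ⊗[k] (U ⊗[k] U)) :=
  Submodule.span k
    ({z | ∃ (a : A) (x y w : U),
        z = (σ.t (op a) * x) ⊗ₜ[k] (y ⊗ₜ[k] w) - x ⊗ₜ[k] ((σ.s a * y) ⊗ₜ[k] w)} ∪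
      {z | ∃ (a : A) (x y w : U),
        z = x ⊗ₜ[k] ((σ.t (op a) * y) ⊗ₜ[k] w) - x ⊗ₜ[k] (y ⊗ₜ[k] (σ.s a * w))})

/-- The triple tensor product `U ⊗_A U ⊗_A U`. -/
abbrev Tens₃ (σ : STRing k A U) : Type _ := (U ⊗[k] (U ⊗[k] U)) ⧸ σ.rel₃

/-- The quotient map `U ⊗ₖ U ⊗ₖ U → U ⊗_A U ⊗_A U`. -/
def cls₃ (σ : STRing k A U) : (U ⊗[k] (U ⊗[k] U)) →ₗ[k] σ.Tens₃ := σ.rel₃.mkQ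

theorem cls₃_rel_left (σ : STRing k A U) (a : A) (x y w : U) :
    σ.cls₃ ((σ.t (op a) * x) ⊗ₜ[k] (y ⊗ₜ[k] w)) =
      σ.cls₃ (x ⊗ₜ[k] ((σ.s a * y) ⊗ₜ[k] w)) := by
  rw [← sub_eq_zero, ← map_sub]
  exact (Submodule.Quotient.mk_eq_zero _).2
    (Submodule.subset_span (Or.inl ⟨a, x, y, w, rfl⟩))

theorem cls₃_rel_right (σ : STRing k A U) (a : A) (x y w : U) :
    σ.cls₃ (x ⊗ₜ[k] ((σ.t (op a) * y) ⊗ₜ[k] w)) =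
      σ.cls₃ (x ⊗ₜ[k] (y ⊗ₜ[k] (σ.s a * w))) := by
  rw [← sub_eq_zero, ← map_sub]
  exact (Submodule.Quotient.mk_eq_zero _).2
    (Submodule.subset_span (Or.inr ⟨a, x, y, w, rfl⟩))

/-- `(x ⊗ y) , w ↦ x ⊗ y ⊗ w`, as a map `U ⊗_A U → U → U ⊗_A U ⊗_A U`. -/
noncomputable def appendRight (σ : STRing k A U) : σ.Tens →ₗ[k] U →ₗ[k] σ.Tens₃ :=
  σ.lift (TensorProduct.curry
      (σ.cls₃ ∘ₗ (TensorProduct.assoc k U U U).toLinearMap)) <| by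
    intro a x y
    ext w
    exact σ.cls₃_rel_left a x y w

@[simp]
theorem appendRight_cls (σ : STRing k A U) (x y w : U) :
    σ.appendRight (σ.cls (x ⊗ₜ[k] y)) w = σ.cls₃ (x ⊗ₜ[k] (y ⊗ₜ[k] w)) :=
  rfl

/-- `(y ⊗ w) , x ↦ x ⊗ y ⊗ w`, as a map `U ⊗_A U → U → U ⊗_A U ⊗_A U`. -/
noncomputable def appendLeft (σ : STRing k A U) : σ.Tens →ₗ[k] U →ₗ[k] σ.Tens₃ :=
  σ.lift ((TensorProduct.mk k U (U ⊗[k] U)).compr₂ σ.cls₃).flip <| by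
    intro a y w
    ext x
    exact σ.cls₃_rel_right a x y w

@[simp]
theorem appendLeft_cls (σ : STRing k A U) (x y w : U) :
    σ.appendLeft (σ.cls (y ⊗ₜ[k] w)) x = σ.cls₃ (x ⊗ₜ[k] (y ⊗ₜ[k] w)) :=
  rfl

/-- A map `Δ : U → U ⊗_A U` of `(A,A)`-bimodules. -/
def IsBimodComul (σ : STRing k A U) (Δ : U →ₗ[k] σ.Tens) : Prop :=
  ∀ (a b : A) (x : U), Δ (σ.s a * (σ.t (op b) * x)) = σ.bimod a b (Δ x)

/-- A map `ε : U → A` of `(A,A)`-bimodules. -/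
def IsBimodCounit (σ : STRing k A U) (ε : U →ₗ[k] A) : Prop :=
  ∀ (a b : A) (x : U), ε (σ.s a * (σ.t (op b) * x)) = a * ε x * b

theorem IsBimodComul.t_mul {σ : STRing k A U} {Δ : U →ₗ[k] σ.Tens} (h : σ.IsBimodComul Δ)
    (a : A) (x : U) : Δ (σ.t (op a) * x) = σ.bimod 1 a (Δ x) := by
  simpa using h 1 a x

theorem IsBimodComul.s_mul {σ : STRing k A U} {Δ : U →ₗ[k] σ.Tens} (h : σ.IsBimodComul Δ)
    (a : A) (x : U) : Δ (σ.s a * x) = σ.bimod a 1 (Δ x) := by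
  simpa using h a 1 x

theorem appendRight_bimod (σ : STRing k A U) (a : A) (z : σ.Tens) (y : U) :
    σ.appendRight (σ.bimod 1 a z) y = σ.appendRight z (σ.s a * y) := by
  have h : (σ.appendRight.flip y) ∘ₗ σ.bimod 1 a = σ.appendRight.flip (σ.s a * y) := by
    refine σ.hom_ext fun p q => ?_
    simp [cls₃_rel_right]
  exact LinearMap.congr_fun h z

theorem appendLeft_bimod (σ : STRing k A U) (a : A) (z : σ.Tens) (x : U) :
    σ.appendLeft (σ.bimod a 1 z) x = σ.appendLeft z (σ.t (op a) * x) := by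
  have h : (σ.appendLeft.flip x) ∘ₗ σ.bimod a 1 = σ.appendLeft.flip (σ.t (op a) * x) := by
    refine σ.hom_ext fun p q => ?_
    simp [cls₃_rel_left]
  exact LinearMap.congr_fun h z

/-- `Δ ⊗ id : U ⊗_A U → U ⊗_A U ⊗_A U`. -/
noncomputable def comulId (σ : STRing k A U) (Δ : U →ₗ[k] σ.Tens) (h : σ.IsBimodComul Δ) :
    σ.Tens →ₗ[k] σ.Tens₃ :=
  σ.lift (TensorProduct.lift (σ.appendRight ∘ₗ Δ)) <| by
    intro a x y
    simp [h.t_mul, appendRight_bimod]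

/-- `id ⊗ Δ : U ⊗_A U → U ⊗_A U ⊗_A U`. -/
noncomputable def idComul (σ : STRing k A U) (Δ : U →ₗ[k] σ.Tens) (h : σ.IsBimodComul Δ) :
    σ.Tens →ₗ[k] σ.Tens₃ :=
  σ.lift (TensorProduct.lift (σ.appendLeft ∘ₗ Δ).flip) <| by
    intro a x y
    simp [h.s_mul, appendLeft_bimod]

/-- `ε ⊗ id : U ⊗_A U → A ⊗_A U = U`, i.e. `x ⊗ y ↦ ε x · y = s (ε x) * y`. -/
noncomputable def counitId (σ : STRing k A U) (ε : U →ₗ[k] A) (h : σ.IsBimodCounit ε) :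
    σ.Tens →ₗ[k] U :=
  σ.lift (TensorProduct.lift ((LinearMap.mul k U) ∘ₗ σ.s.toLinearMap ∘ₗ ε)) <| by
    intro a x y
    have := h 1 a x
    simp only [map_one, one_mul] at this
    simp [this, mul_assoc]

/-- `id ⊗ ε : U ⊗_A U → U ⊗_A A = U`, i.e. `x ⊗ y ↦ x · ε y = t (ε y) * x`. -/
noncomputable def idCounit (σ : STRing k A U) (ε : U →ₗ[k] A) (h : σ.IsBimodCounit ε) :
    σ.Tens →ₗ[k] U :=
  σ.lift (TensorProduct.lift ((LinearMap.mul k U) ∘ₗ σ.t.toLinearMap ∘ₗ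
      (opLinearEquiv k).toLinearMap ∘ₗ ε).flip) <| by
    intro a x y
    have := h a 1 y
    simp only [map_one, one_mul, op_one, mul_one] at this
    simp [this, mul_assoc]

end STRing

/-- A left bialgebroid structure on `U` over the base algebra `A`. -/
structure LeftBialgebroid (k A U : Type*) [Field k] [Ring A] [Algebra k A] [Ring U]
    [Algebra k U] extends STRing k A U where
  /-- the coproduct `Δ_L : U → U ⊗_A U` -/
  Δ : U →ₗ[k] toSTRing.Tens
  /-- the counit `ε_L : U → A` -/
  ε : U →ₗ[k] A
  Δ_bimod : toSTRing.IsBimodComul Δ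
  ε_bimod : toSTRing.IsBimodCounit ε
  coassoc : ∀ x : U, toSTRing.comulId Δ Δ_bimod (Δ x) = toSTRing.idComul Δ Δ_bimod (Δ x)
  counit_left : ∀ x : U, toSTRing.counitId ε ε_bimod (Δ x) = x
  counit_right : ∀ x : U, toSTRing.idCounit ε ε_bimod (Δ x) = x
  Δ_mem_takeuchi : ∀ x : U, Δ x ∈ toSTRing.takeuchi
  Δ_one : Δ 1 = toSTRing.cls (1 ⊗ₜ[k] 1)
  Δ_mul : ∀ x y : U, Δ (x * y) = toSTRing.takMul ⟨Δ x, Δ_mem_takeuchi x⟩ (Δ y)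
  ε_mul_s : ∀ x y : U, ε (x * s (ε y)) = ε (x * y)
  ε_mul_t : ∀ x y : U, ε (x * t (op (ε y))) = ε (x * y)

namespace LeftBialgebroid

variable {k A U : Type*} [Field k] [Ring A] [Algebra k A] [Ring U] [Algebra k U]

theorem Δ_s (B : LeftBialgebroid k A U) (a : A) : B.Δ (B.s a) = B.cls (B.s a ⊗ₜ[k] 1) := by
  have h := B.Δ_bimod.s_mul a 1
  rw [mul_one, B.Δ_one, STRing.bimod_cls] at h
  simpa using h

theorem Δ_t (B : LeftBialgebroid k A U) (a : A) :
    B.Δ (B.t (op a)) = B.cls (1 ⊗ₜ[k] B.t (op a)) := by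
  have h := B.Δ_bimod.t_mul a 1
  rw [mul_one, B.Δ_one, STRing.bimod_cls] at h
  simpa using h

theorem Δ_mul_s (B : LeftBialgebroid k A U) (x : U) (a : A) :
    B.Δ (x * B.s a) = B.rmul (B.Δ x) (B.s a ⊗ₜ[k] 1) := by
  rw [B.Δ_mul, B.Δ_s, STRing.takMul_cls]

theorem Δ_mul_t (B : LeftBialgebroid k A U) (x : U) (a : A) :
    B.Δ (x * B.t (op a)) = B.rmul (B.Δ x) (1 ⊗ₜ[k] B.t (op a)) := by
  rw [B.Δ_mul, B.Δ_t, STRing.takMul_cls]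

end LeftBialgebroid

/-- A left bialgebroid together with an involutive anti-automorphism `S` of the algebra `U` such
that `S ∘ t = s`, on which the two antipode laws will be imposed. -/
structure PreHopfAlgebroid (k A U : Type*) [Field k] [Ring A] [Algebra k A] [Ring U]
    [Algebra k U] extends LeftBialgebroid k A U where
  /-- the antipode -/
  S : U →ₗ[k] U
  S_one : S 1 = 1
  S_mul : ∀ x y : U, S (x * y) = S y * S x
  S_S : ∀ x : U, S (S x) = x
  S_t : ∀ a : A, S (t (op a)) = s a

namespace PreHopfAlgebroid

variable {k A U : Type*} [Field k] [Ring A] [Algebra k A] [Ring U] [Algebra k U]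

theorem S_s (H : PreHopfAlgebroid k A U) (a : A) : H.S (H.s a) = H.t (op a) := by
  rw [← H.S_t, H.S_S]

/-- The map `U ⊗_A U → U ⊗_A U`, `x ⊗ y ↦ S(x)₍₁₎ * y ⊗ S(x)₍₂₎`. -/
noncomputable def antipodeLeft (H : PreHopfAlgebroid k A U) : H.Tens →ₗ[k] H.Tens :=
  H.lift (TensorProduct.lift
      (H.rmul.compl₁₂ (H.Δ ∘ₗ H.S) ((TensorProduct.mk k U U).flip 1))) <| by
    intro a x y
    simp [H.S_mul, H.S_t, H.Δ_mul_s, STRing.rmul_rmul]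

/-- The map `U ⊗_A U → U ⊗_A U`, `x ⊗ y ↦ S(y)₍₁₎ ⊗ S(y)₍₂₎ * x`. -/
noncomputable def antipodeRight (H : PreHopfAlgebroid k A U) : H.Tens →ₗ[k] H.Tens :=
  H.lift (TensorProduct.lift
      (H.rmul.compl₁₂ (H.Δ ∘ₗ H.S) (TensorProduct.mk k U U 1)).flip) <| by
    intro a x y
    simp [H.S_mul, H.S_s, H.Δ_mul_t, STRing.rmul_rmul]

end PreHopfAlgebroid

/-- A Hopf algebroid with total algebra `U`, base algebra `A` and involutive antipode:
`S(x₍₁₎)₍₁₎ * x₍₂₎ ⊗ S(x₍₁₎)₍₂₎ = 1 ⊗ S x` and `S(x₍₂₎)₍₁₎ ⊗ S(x₍₂₎)₍₂₎ * x₍₁₎ = S x ⊗ 1`. -/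
structure HopfAlgebroid (k A U : Type*) [Field k] [Ring A] [Algebra k A] [Ring U]
    [Algebra k U] extends PreHopfAlgebroid k A U where
  antipode_left : ∀ x : U,
    toPreHopfAlgebroid.antipodeLeft (Δ x) = toSTRing.cls (1 ⊗ₜ[k] S x)
  antipode_right : ∀ x : U,
    toPreHopfAlgebroid.antipodeRight (Δ x) = toSTRing.cls (S x ⊗ₜ[k] 1)

/-! ### Coalgebras -/

/-- A subcoalgebra: a subspace `D` with `Δ(D) ⊆ D ⊗ D`. -/
structure Subcoalgebra (k C : Type*) [Field k] [AddCommGroup C] [Module k C] [Coalgebra k C]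
    extends Submodule k C where
  comul_mem : ∀ x ∈ toSubmodule, Coalgebra.comul (R := k) x ∈
    LinearMap.range (TensorProduct.map toSubmodule.subtype toSubmodule.subtype)

namespace Subcoalgebra

variable {k C : Type*} [Field k] [AddCommGroup C] [Module k C] [Coalgebra k C]

/-- The inclusion `D ⊗ D → C ⊗ C`. -/
abbrev incl₂ (D : Subcoalgebra k C) :
    (D.toSubmodule ⊗[k] D.toSubmodule) →ₗ[k] (C ⊗[k] C) :=
  TensorProduct.map D.toSubmodule.subtype D.toSubmodule.subtype

theorem incl₂_injective (D : Subcoalgebra k C) : Function.Injective D.incl₂ :=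
  Module.Flat.tensorProduct_mapIncl_injective_of_right _ _

/-- The coproduct of a subcoalgebra, the restriction of the ambient one. -/
noncomputable def comulRestrict (D : Subcoalgebra k C) :
    D.toSubmodule →ₗ[k] (D.toSubmodule ⊗[k] D.toSubmodule) :=
  (LinearEquiv.ofInjective D.incl₂ D.incl₂_injective).symm.toLinearMap ∘ₗ
    (Coalgebra.comul ∘ₗ D.toSubmodule.subtype).codRestrict (LinearMap.range D.incl₂)
      (fun x => D.comul_mem x.1 x.2)

theorem incl₂_comulRestrict (D : Subcoalgebra k C) (x : D.toSubmodule) :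
    D.incl₂ (D.comulRestrict x) = Coalgebra.comul (R := k) (x : C) := by
  have h := LinearEquiv.apply_symm_apply (LinearEquiv.ofInjective D.incl₂ D.incl₂_injective)
    ((Coalgebra.comul ∘ₗ D.toSubmodule.subtype).codRestrict (LinearMap.range D.incl₂)
      (fun x => D.comul_mem x.1 x.2) x)
  exact congrArg Subtype.val h

noncomputable instance (D : Subcoalgebra k C) : CoalgebraStruct k D.toSubmodule where
  comul := D.comulRestrict
  counit := Coalgebra.counit ∘ₗ D.toSubmodule.subtype

theorem incl₂_comul (D : Subcoalgebra k C) (x : D.toSubmodule) :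
    D.incl₂ (Coalgebra.comul (R := k) x) = Coalgebra.comul (R := k) (x : C) :=
  D.incl₂_comulRestrict x

theorem counit_coe (D : Subcoalgebra k C) (x : D.toSubmodule) :
    Coalgebra.counit (R := k) x = Coalgebra.counit (R := k) (x : C) :=
  rfl

theorem incl₂_comp_comul (D : Subcoalgebra k C) :
    D.incl₂ ∘ₗ Coalgebra.comul (R := k) = Coalgebra.comul ∘ₗ D.toSubmodule.subtype :=
  LinearMap.ext D.incl₂_comul

noncomputable instance (D : Subcoalgebra k C) : Coalgebra k D.toSubmodule where
  coassoc := by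
    have hinj : Function.Injective (TensorProduct.map D.toSubmodule.subtype D.incl₂) :=
      TensorProduct.map_injective_of_flat_flat _ _ Subtype.val_injective D.incl₂_injective
    refine LinearMap.ext fun x => hinj ?_
    have h1 : TensorProduct.map D.toSubmodule.subtype D.incl₂ ∘ₗ
        (TensorProduct.assoc k _ _ _).toLinearMap ∘ₗ Coalgebra.comul.rTensor _ =
        (TensorProduct.assoc k C C C).toLinearMap ∘ₗ Coalgebra.comul.rTensor C ∘ₗ D.incl₂ := by
      have h : TensorProduct.map D.toSubmodule.subtype D.incl₂ ∘ₗ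
          (TensorProduct.assoc k _ _ _).toLinearMap =
          (TensorProduct.assoc k C C C).toLinearMap ∘ₗ
            TensorProduct.map D.incl₂ D.toSubmodule.subtype :=
        TensorProduct.ext_threefold fun _ _ _ => rfl
      rw [← LinearMap.comp_assoc, h, LinearMap.comp_assoc]
      congr 1
      refine TensorProduct.ext' fun p q => ?_
      simp [incl₂_comul]
    have h2 : TensorProduct.map D.toSubmodule.subtype D.incl₂ ∘ₗ Coalgebra.comul.lTensor _ =
        Coalgebra.comul.lTensor C ∘ₗ D.incl₂ := by
      refine TensorProduct.ext' fun p q => ?_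
      simp [incl₂_comul]
    have e1 := LinearMap.congr_fun h1 (Coalgebra.comul (R := k) x)
    have e2 := LinearMap.congr_fun h2 (Coalgebra.comul (R := k) x)
    simp only [LinearMap.comp_apply, incl₂_comul] at e1 e2 ⊢
    rw [e1, e2]
    exact Coalgebra.coassoc_apply (x : C)
  rTensor_counit_comp_comul := by
    have hinj : Function.Injective (D.toSubmodule.subtype.lTensor k) :=
      Module.Flat.lTensor_preserves_injective_linearMap _ Subtype.val_injective
    refine LinearMap.ext fun x => hinj ?_
    have h1 : D.toSubmodule.subtype.lTensor k ∘ₗ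
        (Coalgebra.counit (R := k)).rTensor D.toSubmodule =
        (Coalgebra.counit (R := k)).rTensor C ∘ₗ D.incl₂ :=
      TensorProduct.ext' fun _ _ => rfl
    have e1 := LinearMap.congr_fun h1 (Coalgebra.comul (R := k) x)
    simp only [LinearMap.comp_apply, incl₂_comul] at e1 ⊢
    rw [e1, Coalgebra.rTensor_counit_comul]
    rfl
  lTensor_counit_comp_comul := by
    have hinj : Function.Injective (D.toSubmodule.subtype.rTensor k) :=
      Module.Flat.rTensor_preserves_injective_linearMap _ Subtype.val_injective
    refine LinearMap.ext fun x => hinj ?_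
    have h1 : D.toSubmodule.subtype.rTensor k ∘ₗ
        (Coalgebra.counit (R := k)).lTensor D.toSubmodule =
        (Coalgebra.counit (R := k)).lTensor C ∘ₗ D.incl₂ :=
      TensorProduct.ext' fun _ _ => rfl
    have e1 := LinearMap.congr_fun h1 (Coalgebra.comul (R := k) x)
    simp only [LinearMap.comp_apply, incl₂_comul] at e1 ⊢
    rw [e1, Coalgebra.lTensor_counit_comul]
    rfl

/-- The sum of a set of subcoalgebras. -/
def sSum (𝒟 : Set (Subcoalgebra k C)) : Subcoalgebra k C where
  toSubmodule := ⨆ D ∈ 𝒟, D.toSubmodule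
  comul_mem := by
    suffices h : (⨆ D ∈ 𝒟, D.toSubmodule) ≤ (LinearMap.range (TensorProduct.map
        (⨆ D ∈ 𝒟, D.toSubmodule).subtype (⨆ D ∈ 𝒟, D.toSubmodule).subtype)).comap
          (Coalgebra.comul (R := k)) from fun x hx => h hx
    refine iSup₂_le fun D hD x hx => ?_
    obtain ⟨w, hw⟩ := D.comul_mem x hx
    have hle : D.toSubmodule ≤ ⨆ D ∈ 𝒟, D.toSubmodule := le_iSup₂_of_le D hD le_rfl
    refine ⟨TensorProduct.map (Submodule.inclusion hle) (Submodule.inclusion hle) w, ?_⟩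
    rw [← hw, ← LinearMap.comp_apply, ← TensorProduct.map_comp]
    rfl

theorem isCocomm_iff (D : Subcoalgebra k C) : Coalgebra.IsCocomm k D.toSubmodule ↔
    ∀ x ∈ D.toSubmodule, TensorProduct.comm k C C (Coalgebra.comul (R := k) x) =
      Coalgebra.comul (R := k) x := by
  have key : ∀ w, D.incl₂ (TensorProduct.comm k _ _ w) = TensorProduct.comm k C C (D.incl₂ w) :=
    LinearMap.congr_fun (f := D.incl₂ ∘ₗ (TensorProduct.comm k _ _).toLinearMap)
      (g := (TensorProduct.comm k C C).toLinearMap ∘ₗ D.incl₂)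
      (TensorProduct.ext' fun _ _ => rfl)
  constructor
  · intro h x hx
    have := congrArg D.incl₂ (Coalgebra.comm_comul k (⟨x, hx⟩ : D.toSubmodule))
    rwa [key, incl₂_comul] at this
  · intro h
    refine ⟨LinearMap.ext fun x => D.incl₂_injective ?_⟩
    change D.incl₂ (TensorProduct.comm k _ _ _) = _
    rw [key, incl₂_comul]
    exact h x.1 x.2

theorem isCocomm_sSum (𝒟 : Set (Subcoalgebra k C))
    (h : ∀ D ∈ 𝒟, Coalgebra.IsCocomm k D.toSubmodule) :
    Coalgebra.IsCocomm k (sSum 𝒟).toSubmodule := by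
  rw [isCocomm_iff]
  suffices h' : (⨆ D ∈ 𝒟, D.toSubmodule) ≤ LinearMap.eqLocus
      ((TensorProduct.comm k C C).toLinearMap ∘ₗ Coalgebra.comul (R := k))
      (Coalgebra.comul (R := k)) from fun x hx => h' hx
  exact iSup₂_le fun D hD x hx => (isCocomm_iff D).1 (h D hD) x hx

end Subcoalgebra

/-- A cofree coalgebra on the vector space `V`: a coalgebra with a linear map to `V` through which
every linear map from a coalgebra to `V` factors by a unique coalgebra map. This is a value at `V`,
with its counit, of the right adjoint of the forgetful functor from coalgebras to vector spaces. -/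
structure CofreeCoalgebra (k : Type u) [Field k] (V : Type u) [AddCommGroup V] [Module k V] where
  carrier : Type u
  [addCommGroup : AddCommGroup carrier]
  [module : Module k carrier]
  [coalgebra : Coalgebra k carrier]
  π : carrier →ₗ[k] V
  existsUnique_lift : ∀ (C : Type u) [AddCommGroup C] [Module k C] [Coalgebra k C]
    (g : C →ₗ[k] V), ∃! ξ : C →ₗc[k] carrier, π ∘ₗ ξ.toLinearMap = g

attribute [instance] CofreeCoalgebra.addCommGroup CofreeCoalgebra.module
  CofreeCoalgebra.coalgebra

/-! ### The symmetric monoidal category of cocommutative coalgebras -/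

/-- The flip `C ⊗ D ≅ D ⊗ C` as an isomorphism of coalgebras. -/
noncomputable def CoalgCat.flip {k : Type u} [Field k] (C D : CoalgCat.{u} k) :
    C ⊗ D ≅ D ⊗ C :=
  CoalgEquiv.toCoalgIso (R := k) (X := (C ⊗[k] D)) (Y := (D ⊗[k] C))
  { TensorProduct.comm k C D with
    counit_comp := by
      refine TensorProduct.ext' fun x y => ?_
      simp [mul_comm]
    map_comp_comul := by
      refine TensorProduct.ext' fun x y => ?_
      dsimp
      hopf_tensor_induction Coalgebra.comul (R := k) x with x₁ x₂
      hopf_tensor_induction Coalgebra.comul (R := k) y with y₁ y₂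
      simp }

noncomputable instance (k : Type u) [Field k] :
    (forget₂ (CoalgCat.{u} k) (ModuleCat.{u} k)).Monoidal :=
  Monoidal.fromInducedMonoidal _ (CoalgCat.MonoidalCategory.inducingFunctorData k)

/-- Coalgebras form a symmetric monoidal category under `⊗ₖ`, with the flip as symmetry. -/
noncomputable instance CoalgCat.instBraided (k : Type u) [Field k] :
    BraidedCategory (CoalgCat.{u} k) :=
  BraidedCategory.ofFaithful (forget₂ (CoalgCat.{u} k) (ModuleCat.{u} k)) CoalgCat.flip
    (fun _ _ => ModuleCat.hom_ext (TensorProduct.ext' fun _ _ => rfl))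

noncomputable instance CoalgCat.instSymmetric (k : Type u) [Field k] :
    SymmetricCategory (CoalgCat.{u} k) where
  symmetry X Y := (CoalgCat.flip X Y).hom_inv_id

/-- The property of a coalgebra of being cocommutative. -/
def isCocommProp (k : Type u) [Field k] : ObjectProperty (CoalgCat.{u} k) :=
  fun C => Coalgebra.IsCocomm k C

instance (k : Type u) [Field k] : (isCocommProp k).IsMonoidal where
  prop_unit := inferInstanceAs (Coalgebra.IsCocomm k k)
  prop_tensor X Y hX hY := by
    have : Coalgebra.IsCocomm k X := hX
    have : Coalgebra.IsCocomm k Y := hY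
    exact inferInstanceAs (Coalgebra.IsCocomm k (X ⊗[k] Y))

/-- The category of cocommutative coalgebras, a full monoidal subcategory of coalgebras. -/
abbrev CoCoalg (k : Type u) [Field k] : Type (u + 1) :=
  (isCocommProp k).FullSubcategory

namespace CoCoalg

variable {k : Type u} [Field k]

/-- The object of `CoCoalg k` given by a cocommutative coalgebra. -/
abbrev of (k : Type u) [Field k] (C : Type u) [AddCommGroup C] [Module k C] [Coalgebra k C]
    [h : Coalgebra.IsCocomm k C] : CoCoalg k :=
  ⟨CoalgCat.of k C, h⟩

/-- The linear map underlying a morphism of cocommutative coalgebras. -/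
abbrev lin {X Y : CoCoalg k} (ξ : X ⟶ Y) : X.obj →ₗ[k] Y.obj :=
  ξ.hom.toCoalgHom.toLinearMap

end CoCoalg

/-! ### The category of Hopf algebroids -/

/-- A pair of algebra maps `(F, f)` between Hopf algebroids compatible with sources and targets. -/
structure HopfAlgebroid.PreHom {k A U A' U' : Type*} [Field k] [Ring A] [Algebra k A] [Ring U]
    [Algebra k U] [Ring A'] [Algebra k A'] [Ring U'] [Algebra k U']
    (H : HopfAlgebroid k A U) (H' : HopfAlgebroid k A' U') where
  F : U →ₐ[k] U'
  f : A →ₐ[k] A'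
  source : ∀ a : A, F (H.s a) = H'.s (f a)
  target : ∀ a : A, F (H.t (op a)) = H'.t (op (f a))

namespace HopfAlgebroid

section Hom

variable {k A U A' U' : Type*} [Field k] [Ring A] [Algebra k A] [Ring U]
  [Algebra k U] [Ring A'] [Algebra k A'] [Ring U'] [Algebra k U']
  {H : HopfAlgebroid k A U} {H' : HopfAlgebroid k A' U'}

/-- The map `F ⊗_f F : U ⊗_A U → U' ⊗_A' U'`. -/
noncomputable def PreHom.tens (g : H.PreHom H') : H.Tens →ₗ[k] H'.Tens :=
  H.lift (H'.cls ∘ₗ TensorProduct.map g.F.toLinearMap g.F.toLinearMap) <| by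
    intro a x y
    simp [g.source, g.target, STRing.cls_rel]

@[simp]
theorem PreHom.tens_cls (g : H.PreHom H') (x y : U) :
    g.tens (H.cls (x ⊗ₜ[k] y)) = H'.cls (g.F x ⊗ₜ[k] g.F y) :=
  rfl

end Hom

/-- A morphism of Hopf algebroids. -/
@[ext]
structure Hom {k A U A' U' : Type*} [Field k] [Ring A] [Algebra k A] [Ring U]
    [Algebra k U] [Ring A'] [Algebra k A'] [Ring U'] [Algebra k U']
    (H : HopfAlgebroid k A U) (H' : HopfAlgebroid k A' U') extends PreHom H H' where
  comul : ∀ x : U, H'.Δ (F x) = toPreHom.tens (H.Δ x)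
  counit : ∀ x : U, f (H.ε x) = H'.ε (F x)
  antipode : ∀ x : U, H'.S (F x) = F (H.S x)

end HopfAlgebroid

/-- The objects of the category of Hopf algebroids over `k`. -/
structure HAlg (k : Type u) [Field k] where
  A : Type u
  U : Type u
  [ringA : Ring A]
  [algebraA : Algebra k A]
  [ringU : Ring U]
  [algebraU : Algebra k U]
  str : HopfAlgebroid k A U

namespace HAlg

attribute [instance] ringA algebraA ringU algebraU

variable {k : Type u} [Field k]

instance : Category (HAlg k) where
  Hom X Y := X.str.Hom Y.str
  id X :=
    { F := AlgHom.id k X.U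
      f := AlgHom.id k X.A
      source := fun _ => rfl
      target := fun _ => rfl
      comul := fun x => by
        refine LinearMap.congr_fun (f := LinearMap.id) ?_ _
        exact X.str.hom_ext fun _ _ => rfl
      counit := fun _ => rfl
      antipode := fun _ => rfl }
  comp {X Y Z} g h :=
    { F := h.F.comp g.F
      f := h.f.comp g.f
      source := fun a => by simp [g.source, h.source]
      target := fun a => by simp [g.target, h.target]
      comul := fun x => by
        rw [AlgHom.comp_apply, h.comul, g.comul]
        refine LinearMap.congr_fun (f := h.tens ∘ₗ g.tens) ?_ _
        exact X.str.hom_ext fun _ _ => rfl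
      counit := fun x => by simp [g.counit, h.counit]
      antipode := fun x => by simp [g.antipode, h.antipode] }

end HAlg

/-! ### Measurings -/

/-- A `C`-measuring between algebras `R` and `R'`: `Ψ(x)(ab) = Ψ(x₍₁₎)(a) Ψ(x₍₂₎)(b)` and
`Ψ(x)(1) = ε(x) 1`. -/
structure IsAlgMeasuring {k C R R' : Type*} [Field k] [AddCommGroup C] [Module k C]
    [Coalgebra k C] [Ring R] [Algebra k R] [Ring R'] [Algebra k R']
    (Ψ : C →ₗ[k] R →ₗ[k] R') : Prop where
  map_mul : ∀ (x : C) (a b : R), Ψ x (a * b) =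
    LinearMap.mul' k R' (TensorProduct.map (Ψ.flip a) (Ψ.flip b) (Coalgebra.comul (R := k) x))
  map_one : ∀ x : C, Ψ x 1 = Coalgebra.counit (R := k) x • 1

/-- The map `x ↦ (u ⊗ v ↦ x₍₁₎(u) ⊗ x₍₂₎(v))`. -/
noncomputable def measTensor {k C R R' : Type*} [Field k] [AddCommGroup C] [Module k C]
    [Coalgebra k C] [AddCommGroup R] [Module k R] [AddCommGroup R'] [Module k R']
    (Ψ : C →ₗ[k] R →ₗ[k] R') : C →ₗ[k] (R ⊗[k] R) →ₗ[k] (R' ⊗[k] R') :=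
  TensorProduct.homTensorHomMap (RingHom.id k) R R R' R' ∘ₗ TensorProduct.map Ψ Ψ ∘ₗ Coalgebra.comul

namespace HopfAlgebroid

section Measuring

variable {k C A U A' U' : Type*} [Field k] [AddCommGroup C] [Module k C] [Coalgebra k C]
  [Ring A] [Algebra k A] [Ring U] [Algebra k U]
  [Ring A'] [Algebra k A'] [Ring U'] [Algebra k U']

/-- A pair of algebra measurings compatible with sources, targets, antipodes and counits. -/
structure IsPreMeasuring (H : HopfAlgebroid k A U) (H' : HopfAlgebroid k A' U')
    (Ψ : C →ₗ[k] U →ₗ[k] U') (ψ : C →ₗ[k] A →ₗ[k] A') : Prop where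
  total : IsAlgMeasuring Ψ
  base : IsAlgMeasuring ψ
  source : ∀ (x : C) (a : A), Ψ x (H.s a) = H'.s (ψ x a)
  target : ∀ (x : C) (a : A), Ψ x (H.t (op a)) = H'.t (op (ψ x a))
  antipode : ∀ (x : C) (u : U), Ψ x (H.S u) = H'.S (Ψ x u)
  counit : ∀ (x : C) (u : U), ψ x (H.ε u) = H'.ε (Ψ x u)

theorem leftComm_comul [Coalgebra.IsCocomm k C] (x : C) :
    TensorProduct.leftComm k C C C (Coalgebra.comul.lTensor C (Coalgebra.comul (R := k) x)) =
      Coalgebra.comul.lTensor C (Coalgebra.comul (R := k) x) := by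
  rw [← Coalgebra.coassoc_apply]
  have h : (TensorProduct.leftComm k C C C).toLinearMap ∘ₗ
      (TensorProduct.assoc k C C C).toLinearMap ∘ₗ (Coalgebra.comul (R := k)).rTensor C =
      (TensorProduct.assoc k C C C).toLinearMap ∘ₗ
        ((TensorProduct.comm k C C).toLinearMap ∘ₗ Coalgebra.comul (R := k)).rTensor C := by
    rw [LinearMap.rTensor_comp, ← LinearMap.comp_assoc, ← LinearMap.comp_assoc]
    congr 1
    exact TensorProduct.ext_threefold fun _ _ _ => rfl
  rw [Coalgebra.comm_comp_comul] at h
  exact LinearMap.congr_fun h (Coalgebra.comul (R := k) x)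

variable {H : HopfAlgebroid k A U} {H' : HopfAlgebroid k A' U'}
  {Ψ : C →ₗ[k] U →ₗ[k] U'} {ψ : C →ₗ[k] A →ₗ[k] A'}

theorem IsPreMeasuring.balanced [Coalgebra.IsCocomm k C] (h : IsPreMeasuring H H' Ψ ψ) (x : C)
    (a : A) (u v : U) : H'.cls (measTensor Ψ x ((H.t (op a) * u) ⊗ₜ[k] v)) =
      H'.cls (measTensor Ψ x (u ⊗ₜ[k] (H.s a * v))) := by
  let τ : C →ₗ[k] U' :=
    H'.t.toLinearMap ∘ₗ (opLinearEquiv k).toLinearMap ∘ₗ ψ.flip a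
  let G : C ⊗[k] (C ⊗[k] C) →ₗ[k] H'.Tens :=
    H'.cls ∘ₗ TensorProduct.map (LinearMap.mul' k U') LinearMap.id ∘ₗ
      (TensorProduct.assoc k U' U' U').symm.toLinearMap ∘ₗ
      TensorProduct.map τ (TensorProduct.map (Ψ.flip u) (Ψ.flip v))
  have hG : ∀ p q r, G (p ⊗ₜ[k] (q ⊗ₜ[k] r)) =
      H'.cls ((H'.t (op (ψ p a)) * Ψ q u) ⊗ₜ[k] Ψ r v) := fun _ _ _ => rfl
  let L : C ⊗[k] C →ₗ[k] H'.Tens :=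
    H'.cls ∘ₗ TensorProduct.map (Ψ.flip (H.t (op a) * u)) (Ψ.flip v)
  let R : C ⊗[k] C →ₗ[k] H'.Tens :=
    H'.cls ∘ₗ TensorProduct.map (Ψ.flip u) (Ψ.flip (H.s a * v))
  have hm : ∀ (u v : U) (w : C ⊗[k] C), TensorProduct.homTensorHomMap (RingHom.id k) U U U' U'
      (TensorProduct.map Ψ Ψ w) (u ⊗ₜ[k] v) =
      TensorProduct.map (Ψ.flip u) (Ψ.flip v) w := by
    intro u v w
    induction w with
    | zero => simp
    | tmul p q => simp
    | add p q hp hq => simp only [map_add, LinearMap.add_apply, hp, hq]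
  have hL : L = G ∘ₗ (TensorProduct.assoc k C C C).toLinearMap ∘ₗ
      (Coalgebra.comul (R := k)).rTensor C := by
    refine TensorProduct.ext' fun p q => ?_
    have e : L (p ⊗ₜ[k] q) = H'.cls (Ψ p (H.t (op a) * u) ⊗ₜ[k] Ψ q v) := rfl
    rw [e, h.total.map_mul]
    simp only [LinearMap.comp_apply, LinearMap.rTensor_tmul, LinearEquiv.coe_coe]
    generalize Coalgebra.comul (R := k) p = w
    induction w with
    | zero => simp
    | tmul p q => simp [hG, h.target]
    | add p q hp hq => simp only [map_add, TensorProduct.add_tmul, hp, hq]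
  have hR : R = G ∘ₗ (TensorProduct.leftComm k C C C).toLinearMap ∘ₗ
      (Coalgebra.comul (R := k)).lTensor C := by
    refine TensorProduct.ext' fun p q => ?_
    have e : R (p ⊗ₜ[k] q) = H'.cls (Ψ p u ⊗ₜ[k] Ψ q (H.s a * v)) := rfl
    rw [e, h.total.map_mul]
    simp only [LinearMap.comp_apply, LinearMap.lTensor_tmul, LinearEquiv.coe_coe]
    generalize Coalgebra.comul (R := k) q = w
    induction w with
    | zero => simp
    | tmul q r => simp [hG, h.source, STRing.cls_rel]
    | add p q hp hq => simp only [map_add, TensorProduct.tmul_add, hp, hq]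
  change H'.cls (TensorProduct.homTensorHomMap _ _ _ _ _ (TensorProduct.map Ψ Ψ _) _) =
    H'.cls (TensorProduct.homTensorHomMap _ _ _ _ _ (TensorProduct.map Ψ Ψ _) _)
  rw [hm, hm]
  change L _ = R _
  rw [hL, hR]
  simp only [LinearMap.comp_apply, LinearEquiv.coe_coe, leftComm_comul,
    Coalgebra.coassoc_apply]

/-- The map `U ⊗_A U → U' ⊗_A' U'`, `u ⊗ v ↦ x₍₁₎(u) ⊗ x₍₂₎(v)`, for an element `x` of the
measuring coalgebra. -/
noncomputable def IsPreMeasuring.tens [Coalgebra.IsCocomm k C] (h : IsPreMeasuring H H' Ψ ψ)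
    (x : C) : H.Tens →ₗ[k] H'.Tens :=
  H.lift (H'.cls ∘ₗ measTensor Ψ x) (h.balanced x)

variable (H H' Ψ ψ) in
/-- A measuring from the Hopf algebroid `H` to the Hopf algebroid `H'` by a cocommutative
coalgebra `C`. -/
structure IsMeasuring [Coalgebra.IsCocomm k C] : Prop extends IsPreMeasuring H H' Ψ ψ where
  comul : ∀ (x : C) (u : U), H'.Δ (Ψ x u) = toIsPreMeasuring.tens x (H.Δ u)

/-- The space `V(H, H')` of pairs of linear maps `(F, f)` with `F s = s' f`, `F t = t' f`,
`F S = S' F` and `f ε = ε' F`. -/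
def measSpace (H : HopfAlgebroid k A U) (H' : HopfAlgebroid k A' U') :
    Submodule k ((U →ₗ[k] U') × (A →ₗ[k] A')) where
  carrier := {p | (∀ a, p.1 (H.s a) = H'.s (p.2 a)) ∧
    (∀ a, p.1 (H.t (op a)) = H'.t (op (p.2 a))) ∧
    (∀ u, p.1 (H.S u) = H'.S (p.1 u)) ∧ ∀ u, p.2 (H.ε u) = H'.ε (p.1 u)}
  zero_mem' := by simp
  add_mem' := by
    rintro p q ⟨h1, h2, h3, h4⟩ ⟨h1', h2', h3', h4'⟩
    refine ⟨?_, ?_, ?_, ?_⟩ <;> intro <;> simp [h1, h1', h2, h2', h3, h3', h4, h4']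
  smul_mem' := by
    rintro c p ⟨h1, h2, h3, h4⟩
    refine ⟨?_, ?_, ?_, ?_⟩ <;> intro <;> simp [h1, h2, h3, h4]

/-- The first component of a map to `V(H, H')`. -/
def totalPart (Θ : C →ₗ[k] measSpace H H') : C →ₗ[k] U →ₗ[k] U' :=
  LinearMap.fst k _ _ ∘ₗ (measSpace H H').subtype ∘ₗ Θ

/-- The second component of a map to `V(H, H')`. -/
def basePart (Θ : C →ₗ[k] measSpace H H') : C →ₗ[k] A →ₗ[k] A' :=
  LinearMap.snd k _ _ ∘ₗ (measSpace H H').subtype ∘ₗ Θ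

end Measuring

end HopfAlgebroid

/-! ### The universal measuring coalgebra -/

namespace HAlg

variable {k : Type u} [Field k] {X Y : HAlg k}

/-- The space `V(X, Y)` for two Hopf algebroids. -/
abbrev V (X Y : HAlg k) : Submodule k ((X.U →ₗ[k] Y.U) × (X.A →ₗ[k] Y.A)) :=
  HopfAlgebroid.measSpace X.str Y.str

/-- The cocommutative subcoalgebras `D` of the cofree coalgebra on `V(X, Y)` for which the
restriction to `D` of the canonical map to `V(X, Y)` is a measuring. -/
def measuringSubcoalgebras (K : CofreeCoalgebra k (V X Y)) : Set (Subcoalgebra k K.carrier) :=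
  {D | ∃ _ : Coalgebra.IsCocomm k D.toSubmodule, HopfAlgebroid.IsMeasuring X.str Y.str
    (HopfAlgebroid.totalPart (K.π ∘ₗ D.toSubmodule.subtype))
    (HopfAlgebroid.basePart (K.π ∘ₗ D.toSubmodule.subtype))}

/-- The sum of all cocommutative measuring subcoalgebras of the cofree coalgebra on `V(X, Y)`. -/
def measuringSum (K : CofreeCoalgebra k (V X Y)) : Subcoalgebra k K.carrier :=
  Subcoalgebra.sSum (measuringSubcoalgebras K)

instance (K : CofreeCoalgebra k (V X Y)) :
    Coalgebra.IsCocomm k (measuringSum K).toSubmodule :=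
  Subcoalgebra.isCocomm_sSum _ fun _ hD => hD.1

/-- The coalgebra `M_c(X, Y)`, as an object of the category of cocommutative coalgebras. -/
noncomputable def Mc (K : CofreeCoalgebra k (V X Y)) : CoCoalg k :=
  CoCoalg.of k (measuringSum K).toSubmodule

instance (K : CofreeCoalgebra k (V X Y)) : Coalgebra.IsCocomm k (Mc K).obj :=
  (Mc K).property

/-- The restriction to `M_c(X, Y)` of the canonical map from the cofree coalgebra to `V(X, Y)`. -/
noncomputable def McMap (K : CofreeCoalgebra k (V X Y)) : (Mc K).obj →ₗ[k] V X Y :=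
  K.π ∘ₗ (measuringSum K).toSubmodule.subtype

/-- The component `Φ : M_c(X, Y) → Vect(U, U')` of the canonical map. -/
noncomputable def McTotal (K : CofreeCoalgebra k (V X Y)) :
    (Mc K).obj →ₗ[k] X.U →ₗ[k] Y.U :=
  HopfAlgebroid.totalPart (McMap K)

/-- The component `φ : M_c(X, Y) → Vect(A, A')` of the canonical map. -/
noncomputable def McBase (K : CofreeCoalgebra k (V X Y)) :
    (Mc K).obj →ₗ[k] X.A →ₗ[k] Y.A :=
  HopfAlgebroid.basePart (McMap K)

end HAlg

/-- For `Ψ : C → Vect(R, R')` and `Ψ' : C' → Vect(R', R'')`, the map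
`C ⊗ C' → Vect(R, R'')`, `x ⊗ x' ↦ Ψ'(x') ∘ Ψ(x)`. -/
noncomputable def compMeasuring {k C C' R R' R'' : Type*} [Field k] [AddCommGroup C] [Module k C]
    [AddCommGroup C'] [Module k C'] [AddCommGroup R] [Module k R] [AddCommGroup R'] [Module k R']
    [AddCommGroup R''] [Module k R''] (Ψ : C →ₗ[k] R →ₗ[k] R') (Ψ' : C' →ₗ[k] R' →ₗ[k] R'') :
    (C ⊗[k] C') →ₗ[k] R →ₗ[k] R'' :=
  TensorProduct.lift ((LinearMap.llcomp k R R' R'').flip.compl₁₂ Ψ Ψ')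

theorem compMeasuring_tmul {k C C' R R' R'' : Type*} [Field k] [AddCommGroup C] [Module k C]
    [AddCommGroup C'] [Module k C'] [AddCommGroup R] [Module k R] [AddCommGroup R'] [Module k R']
    [AddCommGroup R''] [Module k R''] (Ψ : C →ₗ[k] R →ₗ[k] R') (Ψ' : C' →ₗ[k] R' →ₗ[k] R'')
    (x : C) (x' : C') : compMeasuring Ψ Ψ' (x ⊗ₜ[k] x') = Ψ' x' ∘ₗ Ψ x :=
  rfl

/-- The map `k → Vect(R, R)`, `t ↦ t · id`. -/
def unitMeasuring (k R : Type*) [Field k] [AddCommGroup R] [Module k R] : k →ₗ[k] R →ₗ[k] R :=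
  LinearMap.toSpanSingleton k _ LinearMap.id

/-! Cofree coalgebras. Every element of a coalgebra lies in a subcoalgebra of countable dimension
(`exists_mem_countable`), so every coalgebra is a quotient of a direct sum of coalgebras taken from
one small family: those carried by quotients of `ℕ →₀ k`. The cofree coalgebra on `V` is the direct
sum of all members of this family labelled by linear maps to `V`, modulo the largest coideal killed
by the map to `V`. In this quotient a coideal killed by the map to `V` is zero
(`eq_bot_of_isCoideal`). This yields uniqueness of lifts, since the image of a difference of two
coalgebra maps is a coideal. It also yields existence: for a cover `p` of `C`, the evident map from
the cover to the quotient sends `ker p` to a coideal killed by the map to `V`, so it descends to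
`C`.

Universal measurings. The conditions that a measuring imposes at `x` are jointly linear in the
action of `x`, the action of `x₍₁₎ ⊗ x₍₂₎` and the counit of `x`. The elements satisfying them
therefore form a subspace (`measuringLocus`), and this subspace pulls back along coalgebra maps
(`mem_measuringLocus_comp`). Hence the sum of the measuring subcoalgebras is again measuring. The
lift of a measuring to the cofree coalgebra has a cocommutative measuring subcoalgebra as its image,
so it lands in that sum.

Enrichment. Coalgebra maps into `Mc` are determined by the linear maps they induce, so the axioms
reduce to associativity and unitality of composition of linear maps. The element `1 : k` is
grouplike, so the measurings by `k` are exactly the multiples `c ↦ (c • F, c • f)` of morphisms;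
this identifies the underlying category. -/

/-! ### Coideals -/

namespace Submodule

variable {k C D E : Type*} [Field k] [AddCommGroup C] [Module k C] [Coalgebra k C]
  [AddCommGroup D] [Module k D] [Coalgebra k D] [AddCommGroup E] [Module k E] [Coalgebra k E]

/-- The quotient by the supremum factors through the quotient by each member, so what vanishes
modulo a member vanishes modulo the supremum. This makes a largest coideal inside a given kernel
available. -/
theorem isCoideal_sSup (𝒥 : Set (Submodule k C)) (h : ∀ J ∈ 𝒥, J.IsCoideal) :
    (sSup 𝒥).IsCoideal where
  counit_eq_zero := by
    suffices h' : sSup 𝒥 ≤ LinearMap.ker (Coalgebra.counit (R := k) (A := C)) from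
      fun x hx => h' hx
    exact sSup_le fun J hJ x hx => (h J hJ).counit_eq_zero hx
  map_mkQ_comul_eq_zero := by
    suffices h' : sSup 𝒥 ≤ LinearMap.ker
        (TensorProduct.map (sSup 𝒥).mkQ (sSup 𝒥).mkQ ∘ₗ Coalgebra.comul (R := k)) from
      fun x hx => h' hx
    refine sSup_le fun J hJ x hx => ?_
    have e : (sSup 𝒥).mkQ = factor (le_sSup hJ) ∘ₗ J.mkQ := rfl
    rw [LinearMap.mem_ker, e, TensorProduct.map_comp, LinearMap.comp_apply, LinearMap.comp_apply,
      (h J hJ).map_mkQ_comul_eq_zero hx, map_zero]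

/-- Modulo the image of `f - g` the two maps agree, hence so do their tensor squares applied to the
coproduct. Used for uniqueness of lifts. -/
theorem isCoideal_range_sub (f g : C →ₗc[k] D) :
    (LinearMap.range (f.toLinearMap - g.toLinearMap)).IsCoideal where
  counit_eq_zero := by
    rintro _ ⟨c, rfl⟩
    simp
  map_mkQ_comul_eq_zero := by
    rintro _ ⟨c, rfl⟩
    have e : (LinearMap.range (f.toLinearMap - g.toLinearMap)).mkQ ∘ₗ f.toLinearMap =
        (LinearMap.range (f.toLinearMap - g.toLinearMap)).mkQ ∘ₗ g.toLinearMap := by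
      ext c
      exact (Submodule.Quotient.eq _).2 ⟨c, rfl⟩
    rw [LinearMap.sub_apply, map_sub, map_sub, sub_eq_zero]
    have hf := LinearMap.congr_fun f.map_comp_comul c
    have hg := LinearMap.congr_fun g.map_comp_comul c
    simp only [LinearMap.comp_apply] at hf hg
    rw [← hf, ← hg, TensorProduct.map_map, TensorProduct.map_map, e]

/-- Modulo `f (ker p)` the map `f` factors linearly through `p`, and the coproduct of an element of
`ker p` dies under `p ⊗ p`. Used to descend a coalgebra map along a surjection. -/
theorem isCoideal_map_ker (p : E →ₗc[k] C) (hp : Function.Surjective p) (f : E →ₗc[k] D) :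
    ((LinearMap.ker p.toLinearMap).map f.toLinearMap).IsCoideal where
  counit_eq_zero := by
    rintro _ ⟨e, he, rfl⟩
    have hc : p e = 0 := he
    have : Coalgebra.counit (R := k) (p e) = Coalgebra.counit (R := k) (f e) := by simp
    rw [hc, map_zero] at this
    exact this.symm
  map_mkQ_comul_eq_zero := by
    rintro _ ⟨e, he, rfl⟩
    set J := (LinearMap.ker p.toLinearMap).map f.toLinearMap with hJ
    have hker : LinearMap.ker p.toLinearMap ≤ LinearMap.ker (J.mkQ ∘ₗ f.toLinearMap) :=
      fun x hx => (Submodule.Quotient.mk_eq_zero _).2 ⟨x, hx, rfl⟩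
    -- A linear section suffices: the factorization through `p` need only be linear.
    obtain ⟨s, hs⟩ := p.toLinearMap.exists_rightInverse_of_surjective
      (LinearMap.range_eq_top.2 hp)
    have hfac : J.mkQ ∘ₗ f.toLinearMap = (J.mkQ ∘ₗ f.toLinearMap ∘ₗ s) ∘ₗ p.toLinearMap := by
      ext x
      rw [← sub_eq_zero]
      have hx : x - s (p x) ∈ LinearMap.ker p.toLinearMap := by
        have := LinearMap.congr_fun hs (p x)
        simp only [LinearMap.comp_apply, LinearMap.id_apply] at this
        rw [LinearMap.mem_ker, map_sub, this]
        exact sub_self _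
      have := hker hx
      rwa [LinearMap.mem_ker, map_sub] at this
    have hf := LinearMap.congr_fun f.map_comp_comul e
    have hg := LinearMap.congr_fun p.map_comp_comul e
    simp only [LinearMap.comp_apply] at hf hg
    rw [← hf, ← LinearMap.comp_apply, ← TensorProduct.map_comp, hfac, TensorProduct.map_comp,
      LinearMap.comp_apply, hg]
    have he' : p.toLinearMap e = 0 := he
    rw [he', map_zero, map_zero]

end Submodule

/-! ### Coalgebra maps -/

/-- A linear map through which a surjective coalgebra map and a further coalgebra map factor is a
coalgebra map. -/
def CoalgHom.ofSurjective {k E C D : Type*} [Field k] [AddCommGroup C] [Module k C]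
    [Coalgebra k C] [AddCommGroup D] [Module k D] [Coalgebra k D] [AddCommGroup E] [Module k E]
    [Coalgebra k E] (p : E →ₗc[k] C) (hp : Function.Surjective p) (f : E →ₗc[k] D)
    (g : C →ₗ[k] D) (hg : g ∘ₗ p.toLinearMap = f.toLinearMap) : C →ₗc[k] D where
  __ := g
  counit_comp := by
    -- Since `p` is surjective, both axioms may be tested after precomposition with it, where they
    -- become those of `f`.
    rw [← LinearMap.cancel_right (g := p.toLinearMap) hp, LinearMap.comp_assoc, hg,
      f.counit_comp, p.counit_comp]
  map_comp_comul := by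
    rw [← LinearMap.cancel_right (g := p.toLinearMap) hp, LinearMap.comp_assoc,
      ← p.map_comp_comul, ← LinearMap.comp_assoc, ← TensorProduct.map_comp, hg,
      f.map_comp_comul, LinearMap.comp_assoc, hg]

/-- The coalgebra map out of a direct sum determined by coalgebra maps out of the summands. -/
noncomputable def DFinsupp.coalgHomLsum {k ι D : Type*} {A : ι → Type*} [Field k] [DecidableEq ι]
    [∀ i, AddCommGroup (A i)] [∀ i, Module k (A i)] [∀ i, Coalgebra k (A i)]
    [AddCommGroup D] [Module k D] [Coalgebra k D] (f : ∀ i, A i →ₗc[k] D) :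
    (Π₀ i, A i) →ₗc[k] D where
  __ := DFinsupp.lsum k fun i => (f i).toLinearMap
  counit_comp := by
    refine DFinsupp.lhom_ext fun i a => ?_
    simp
  map_comp_comul := by
    refine DFinsupp.lhom_ext fun i a => ?_
    have h : DFinsupp.lsum k (fun i => (f i).toLinearMap) ∘ₗ DFinsupp.lsingle i =
        (f i).toLinearMap := by
      ext x
      simp
    have h' := LinearMap.congr_fun (f i).map_comp_comul a
    simp only [LinearMap.comp_apply] at h' ⊢
    rw [DFinsupp.comul_single, ← LinearMap.comp_apply, ← TensorProduct.map_comp, h, h']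
    simp

@[simp]
theorem DFinsupp.coalgHomLsum_single {k ι D : Type*} {A : ι → Type*} [Field k] [DecidableEq ι]
    [∀ i, AddCommGroup (A i)] [∀ i, Module k (A i)] [∀ i, Coalgebra k (A i)]
    [AddCommGroup D] [Module k D] [Coalgebra k D] (f : ∀ i, A i →ₗc[k] D) (i : ι) (a : A i) :
    DFinsupp.coalgHomLsum f (DFinsupp.single i a) = f i a :=
  DFinsupp.lsum_single _ _ _ _

/-- The inclusion of a summand into a direct sum of coalgebras. -/
noncomputable def DFinsupp.coalgHomSingle (k : Type*) {ι : Type*} {A : ι → Type*} [Field k]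
    [DecidableEq ι] [∀ i, AddCommGroup (A i)] [∀ i, Module k (A i)] [∀ i, Coalgebra k (A i)]
    (i : ι) : A i →ₗc[k] (Π₀ i, A i) where
  __ := DFinsupp.lsingle i
  counit_comp := by
    ext a
    simp
  map_comp_comul := (DFinsupp.comul_comp_lsingle k ι A i).symm

/-- Transport of a coalgebra structure along a linear equivalence. -/
noncomputable abbrev LinearEquiv.coalgebra {k M C : Type*} [Field k] [AddCommGroup M] [Module k M]
    [AddCommGroup C] [Module k C] [Coalgebra k C] (e : M ≃ₗ[k] C) : Coalgebra k M where
  comul := TensorProduct.map e.symm.toLinearMap e.symm.toLinearMap ∘ₗ Coalgebra.comul ∘ₗ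
    e.toLinearMap
  counit := Coalgebra.counit ∘ₗ e.toLinearMap
  coassoc := by
    ext x
    -- Coassociativity in `C` at `e x`, carried back by the triple tensor power of `e.symm`; what
    -- remains is to cancel the inner `e` against `e.symm`.
    have h := congrArg (TensorProduct.map e.symm.toLinearMap
      (TensorProduct.map e.symm.toLinearMap e.symm.toLinearMap))
      (Coalgebra.coassoc_apply (R := k) (e x))
    simp only [LinearMap.comp_apply, LinearEquiv.coe_coe] at h ⊢
    generalize Coalgebra.comul (R := k) (e x) = w at h ⊢
    convert h using 1 <;> clear h
    · induction w with
      | zero => simp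
      | add p q hp hq => simp only [map_add, hp, hq]
      | tmul p q =>
        simp only [TensorProduct.map_tmul, LinearMap.rTensor_tmul, LinearMap.comp_apply,
          LinearEquiv.coe_coe, LinearEquiv.apply_symm_apply]
        generalize Coalgebra.comul (R := k) p = w
        induction w with
        | zero => simp
        | add p q hp hq => simp only [map_add, TensorProduct.add_tmul, hp, hq]
        | tmul p q => simp
    · induction w with
      | zero => simp
      | add p q hp hq => simp only [map_add, hp, hq]
      | tmul p q => simp
  rTensor_counit_comp_comul := by
    ext x
    have h := congrArg (e.symm.toLinearMap.lTensor k)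
      (Coalgebra.rTensor_counit_comul (R := k) (e x))
    simp only [LinearMap.comp_apply, LinearEquiv.coe_coe, LinearMap.lTensor_tmul,
      LinearEquiv.symm_apply_apply] at h ⊢
    refine Eq.trans ?_ h
    generalize Coalgebra.comul (R := k) (e x) = w
    induction w with
    | zero => simp
    | add p q hp hq => simp only [map_add, hp, hq]
    | tmul p q => simp
  lTensor_counit_comp_comul := by
    ext x
    have h := congrArg (e.symm.toLinearMap.rTensor k)
      (Coalgebra.lTensor_counit_comul (R := k) (e x))
    simp only [LinearMap.comp_apply, LinearEquiv.coe_coe, LinearMap.rTensor_tmul,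
      LinearEquiv.symm_apply_apply] at h ⊢
    refine Eq.trans ?_ h
    generalize Coalgebra.comul (R := k) (e x) = w
    induction w with
    | zero => simp
    | add p q hp hq => simp only [map_add, hp, hq]
    | tmul p q => simp

/-- A linear equivalence as a coalgebra map for the transported structure. -/
noncomputable def LinearEquiv.coalgHom {k M C : Type*} [Field k] [AddCommGroup M] [Module k M]
    [AddCommGroup C] [Module k C] [Coalgebra k C] (e : M ≃ₗ[k] C) :
    letI := e.coalgebra
    M →ₗc[k] C :=
  letI := e.coalgebra
  { e.toLinearMap with
    counit_comp := rfl
    map_comp_comul := by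
      change TensorProduct.map e.toLinearMap e.toLinearMap ∘ₗ
        TensorProduct.map e.symm.toLinearMap e.symm.toLinearMap ∘ₗ Coalgebra.comul ∘ₗ
          e.toLinearMap = _
      rw [← LinearMap.comp_assoc, ← TensorProduct.map_comp, LinearEquiv.comp_coe,
        LinearEquiv.symm_trans_self, LinearEquiv.refl_toLinearMap, TensorProduct.map_id,
        LinearMap.id_comp] }

/-! ### Subcoalgebras of countable dimension. -/

namespace Subcoalgebra

variable {k C D : Type*} [Field k] [AddCommGroup C] [Module k C] [Coalgebra k C]
  [AddCommGroup D] [Module k D] [Coalgebra k D]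

/-- The inclusion of a subcoalgebra. -/
noncomputable def incl (D : Subcoalgebra k C) : D.toSubmodule →ₗc[k] C where
  __ := D.toSubmodule.subtype
  counit_comp := rfl
  map_comp_comul := D.incl₂_comp_comul

/-- Every element lies in a subcoalgebra of countable dimension. -/
theorem exists_mem_countable (c : C) : ∃ D : Subcoalgebra k C, c ∈ D.toSubmodule ∧
    ∃ s : Set C, s.Countable ∧ D.toSubmodule = Submodule.span k s := by
  classical
  -- The coproducts of finitely many elements involve only finitely many tensor legs on either side.
  have step : ∀ s : Finset C, ∃ s' : Finset C, ∀ x ∈ s, Coalgebra.comul (R := k) x ∈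
      LinearMap.range (TensorProduct.map (Submodule.span k (s' : Set C)).subtype
        (Submodule.span k (s' : Set C)).subtype) := by
    intro s
    obtain ⟨M, N, hM, hN, h⟩ := TensorProduct.exists_finite_submodule_of_setFinite
      ((fun x => Coalgebra.comul (R := k) x) '' (s : Set C)) (s.finite_toSet.image _)
    obtain ⟨m, rfl⟩ := Module.Finite.iff_fg.1 hM
    obtain ⟨n, rfl⟩ := Module.Finite.iff_fg.1 hN
    refine ⟨m ∪ n, fun x hx => ?_⟩
    refine TensorProduct.range_mapIncl_mono ?_ ?_ (h ⟨x, hx, rfl⟩) <;>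
      exact Submodule.span_mono (by simp)
  choose next hnext using step
  -- The coproduct of stage `n` lies in the tensor square of the span of stage `n + 1`, so the span
  -- of the union is closed under the coproduct. Countability is all that is needed.
  let s : ℕ → Finset C := fun n => next^[n] {c}
  have hs : ∀ n, s (n + 1) = next (s n) := fun n => Function.iterate_succ_apply' _ _ _
  let S : Set C := ⋃ n, (s n : Set C)
  have hle : ∀ n, Submodule.span k (s n : Set C) ≤ Submodule.span k S := fun n =>
    Submodule.span_mono (Set.subset_iUnion (fun n => (s n : Set C)) n)
  refine ⟨⟨Submodule.span k S, ?_⟩, hle 0 (Submodule.subset_span (by simp [s])), S,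
    Set.countable_iUnion fun n => (s n).countable_toSet, rfl⟩
  suffices h : Submodule.span k S ≤ (LinearMap.range (TensorProduct.map
      (Submodule.span k S).subtype (Submodule.span k S).subtype)).comap
        (Coalgebra.comul (R := k)) from fun x hx => h hx
  refine Submodule.span_le.2 fun x hx => ?_
  obtain ⟨n, hn⟩ := Set.mem_iUnion.1 hx
  have := hnext (s n) x hn
  rw [← hs] at this
  exact TensorProduct.range_mapIncl_mono (hle _) (hle _) this

end Subcoalgebra

/-! ### Cofree coalgebras -/

/-- A coalgebra structure on a quotient of the vector space with basis `ℕ`. Up to isomorphism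
these are all the coalgebras of countable dimension. -/
structure CountableCoalgebra (k : Type u) [Field k] where
  ker : Submodule k (ℕ →₀ k)
  coalgebra : Coalgebra k ((ℕ →₀ k) ⧸ ker)

namespace CountableCoalgebra

variable {k : Type u} [Field k]

/-- The underlying space. -/
def Carrier (i : CountableCoalgebra k) : Type u := (ℕ →₀ k) ⧸ i.ker

noncomputable instance (i : CountableCoalgebra k) : AddCommGroup i.Carrier :=
  inferInstanceAs (AddCommGroup ((ℕ →₀ k) ⧸ i.ker))

noncomputable instance (i : CountableCoalgebra k) : Module k i.Carrier :=
  inferInstanceAs (Module k ((ℕ →₀ k) ⧸ i.ker))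

noncomputable instance (i : CountableCoalgebra k) : Coalgebra k i.Carrier := i.coalgebra

/-- A countable spanning set presents the subcoalgebra around `c` as a quotient of `ℕ →₀ k`, to
which its coalgebra structure is transported. The indexing family does not depend on `C`. -/
theorem exists_hom {C : Type*} [AddCommGroup C] [Module k C] [Coalgebra k C] (c : C) :
    ∃ (i : CountableCoalgebra k) (f : i.Carrier →ₗc[k] C) (x : i.Carrier), f x = c := by
  obtain ⟨D, hc, s, hs, hD⟩ := Subcoalgebra.exists_mem_countable (k := k) c
  -- Adjoining `0` leaves the span unchanged and makes the set nonempty, so `ℕ` can enumerate it.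
  obtain ⟨v, hv⟩ : ∃ v : ℕ → C, insert 0 s = Set.range v :=
    (hs.insert 0).exists_eq_range ⟨0, by simp⟩
  have hr : LinearMap.range (Finsupp.linearCombination k v) = D.toSubmodule := by
    rw [Finsupp.range_linearCombination, ← hv, hD, Submodule.span_insert_zero]
  let e : ((ℕ →₀ k) ⧸ LinearMap.ker (Finsupp.linearCombination k v)) ≃ₗ[k] D.toSubmodule :=
    (Finsupp.linearCombination k v).quotKerEquivRange.trans (LinearEquiv.ofEq _ _ hr)
  refine ⟨{ ker := _, coalgebra := e.coalgebra }, ?_, e.symm ⟨c, hc⟩, ?_⟩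
  · letI := e.coalgebra
    exact D.incl.comp e.coalgHom
  · exact congrArg Subtype.val (e.apply_symm_apply ⟨c, hc⟩)

end CountableCoalgebra

namespace CofreeCoalgebra

variable (k : Type u) [Field k] (V : Type u) [AddCommGroup V] [Module k V]

open scoped Classical in
/-- The direct sum of all countable coalgebras equipped with a linear map to `V`. -/
abbrev Cover : Type u :=
  Π₀ i : (Σ i : CountableCoalgebra k, i.Carrier →ₗ[k] V), i.1.Carrier

open scoped Classical in
noncomputable instance : Coalgebra k (Cover k V) := inferInstance

open scoped Classical in
/-- The canonical map to `V`. -/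
noncomputable def coverMap : Cover k V →ₗ[k] V := DFinsupp.lsum k fun i => i.2

open scoped Classical in
theorem coverMap_single (i : Σ i : CountableCoalgebra k, i.Carrier →ₗ[k] V) (x : i.1.Carrier) :
    coverMap k V (DFinsupp.single i x) = i.2 x := by
  simp [coverMap]

/-- The largest coideal on which the canonical map to `V` vanishes. -/
noncomputable def coverCoideal : Submodule k (Cover k V) :=
  sSup {J | J.IsCoideal ∧ J ≤ LinearMap.ker (coverMap k V)}

instance : (coverCoideal k V).IsCoideal :=
  Submodule.isCoideal_sSup _ fun _ h => h.1

theorem coverCoideal_le : coverCoideal k V ≤ LinearMap.ker (coverMap k V) :=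
  sSup_le fun _ h => h.2

/-- The quotient of the direct sum of all countable coalgebras over `V` by the largest coideal on
which the map to `V` vanishes. -/
abbrev Model : Type u := Cover k V ⧸ coverCoideal k V

/-- The canonical map to `V`. -/
noncomputable def modelMap : Model k V →ₗ[k] V :=
  (coverCoideal k V).liftQ (coverMap k V) (coverCoideal_le k V)

variable {k V}

/-- A coideal of the model on which the map to `V` vanishes is zero. -/
theorem eq_bot_of_isCoideal (J : Submodule k (Model k V)) (hJ : J.IsCoideal)
    (h : J ≤ LinearMap.ker (modelMap k V)) : J = ⊥ := by
  -- The preimage of `J` in the cover is again a coideal killed by the map to `V`, so maximality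
  -- applies.
  have key : J.comap (coverCoideal k V).mkQ ≤ coverCoideal k V := by
    refine le_sSup ⟨⟨fun x hx => hJ.counit_eq_zero hx, fun x hx => ?_⟩, fun x hx => h hx⟩
    have h0 := hJ.map_mkQ_comul_eq_zero hx
    let q := (J.comap (coverCoideal k V).mkQ).mkQ
    have hle : coverCoideal k V ≤ J.comap (coverCoideal k V).mkQ := fun y hy => by
      rw [Submodule.mem_comap, Submodule.mkQ_apply, (Submodule.Quotient.mk_eq_zero _).2 hy]
      exact J.zero_mem
    let r : Model k V →ₗ[k] _ := Submodule.factor hle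
    have hr : ∀ y ∈ J, r y = 0 := by
      intro y hy
      obtain ⟨y, rfl⟩ := Submodule.mkQ_surjective _ y
      exact (Submodule.Quotient.mk_eq_zero _).2 hy
    let t : Model k V ⧸ J →ₗ[k] _ := J.liftQ r hr
    -- The quotient by the preimage factors through the quotient of the model by `J`, where the
    -- coproduct is already known to vanish.
    have hq : q = (t ∘ₗ J.mkQ) ∘ₗ (coverCoideal k V).mkQ := rfl
    change TensorProduct.map q q _ = 0
    rw [hq, TensorProduct.map_comp, TensorProduct.map_comp, LinearMap.comp_apply,
      LinearMap.comp_apply]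
    change TensorProduct.map t t (TensorProduct.map J.mkQ J.mkQ (Coalgebra.comul (R := k)
      ((coverCoideal k V).mkQ x))) = 0
    rw [h0, map_zero]
  rw [eq_bot_iff]
  intro y hy
  obtain ⟨y, rfl⟩ := Submodule.mkQ_surjective _ y
  exact (Submodule.Quotient.mk_eq_zero _).2 (key hy)

section

variable {C : Type u} [AddCommGroup C] [Module k C] [Coalgebra k C]

theorem modelMap_hom_ext {f g : C →ₗc[k] Model k V}
    (h : modelMap k V ∘ₗ f.toLinearMap = modelMap k V ∘ₗ g.toLinearMap) : f = g := by
  have hb := eq_bot_of_isCoideal _ (Submodule.isCoideal_range_sub f g) <| by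
    rintro _ ⟨c, rfl⟩
    have := LinearMap.congr_fun h c
    rw [LinearMap.mem_ker, LinearMap.sub_apply, map_sub, sub_eq_zero]
    exact this
  rw [LinearMap.range_eq_bot, sub_eq_zero] at hb
  exact CoalgHom.ext fun c => LinearMap.congr_fun hb c

/-- The lift is evident on a direct sum `p` of countable coalgebras covering `C`; the absence of
nonzero coideals over `V` forces it to vanish on `ker p`. -/
theorem exists_lift_model (g : C →ₗ[k] V) :
    ∃ ξ : C →ₗc[k] Model k V, modelMap k V ∘ₗ ξ.toLinearMap = g := by
  classical
  let ι := Σ i : CountableCoalgebra k, i.Carrier →ₗc[k] C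
  let p : (Π₀ i : ι, i.1.Carrier) →ₗc[k] C := DFinsupp.coalgHomLsum fun i => i.2
  have hp : Function.Surjective p := by
    intro c
    obtain ⟨i, f, x, rfl⟩ := CountableCoalgebra.exists_hom (k := k) c
    exact ⟨DFinsupp.single (⟨i, f⟩ : ι) x, DFinsupp.coalgHomLsum_single _ _ _⟩
  -- The summand with structure map `f` to `C` goes to the summand of the cover of `V` labelled by
  -- `g ∘ f`.
  let η : (Π₀ i : ι, i.1.Carrier) →ₗc[k] Model k V := DFinsupp.coalgHomLsum fun i =>
    (Coalgebra.Quotient.mkQCoalgHom (coverCoideal k V)).comp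
      (DFinsupp.coalgHomSingle k
        (A := fun i : Σ i : CountableCoalgebra k, i.Carrier →ₗ[k] V => i.1.Carrier)
        (⟨i.1, g ∘ₗ i.2.toLinearMap⟩ : Σ i : CountableCoalgebra k, i.Carrier →ₗ[k] V))
  have hη : modelMap k V ∘ₗ η.toLinearMap = g ∘ₗ p.toLinearMap := by
    refine DFinsupp.lhom_ext fun i a => ?_
    change modelMap k V (η (DFinsupp.single i a)) = g (p (DFinsupp.single i a))
    rw [DFinsupp.coalgHomLsum_single, DFinsupp.coalgHomLsum_single]
    exact coverMap_single _ _ ⟨i.1, g ∘ₗ i.2.toLinearMap⟩ a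
  have hb := eq_bot_of_isCoideal _ (Submodule.isCoideal_map_ker p hp η) <| by
    rintro _ ⟨c, hc, rfl⟩
    have := LinearMap.congr_fun hη c
    rw [LinearMap.mem_ker]
    refine this.trans ?_
    rw [LinearMap.comp_apply, LinearMap.mem_ker.1 hc, map_zero]
  rw [← LinearMap.le_ker_iff_map] at hb
  obtain ⟨s, hs⟩ := p.toLinearMap.exists_rightInverse_of_surjective
    (LinearMap.range_eq_top.2 hp)
  -- As `η` kills `ker p`, the map `η ∘ s` does not see the choice of section and is the descended
  -- map.
  have hfac : (η.toLinearMap ∘ₗ s) ∘ₗ p.toLinearMap = η.toLinearMap := by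
    refine LinearMap.ext fun x => ?_
    have hx : s (p x) - x ∈ LinearMap.ker p.toLinearMap := by
      rw [LinearMap.mem_ker, map_sub, sub_eq_zero]
      exact LinearMap.congr_fun hs (p x)
    have := hb hx
    rw [LinearMap.mem_ker, map_sub, sub_eq_zero] at this
    exact this
  refine ⟨CoalgHom.ofSurjective p hp η _ hfac, ?_⟩
  change modelMap k V ∘ₗ η.toLinearMap ∘ₗ s = g
  rw [← LinearMap.comp_assoc, hη, LinearMap.comp_assoc, hs, LinearMap.comp_id]

end

variable (k V) in
/-- The cofree coalgebra on a vector space. -/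
noncomputable def model : CofreeCoalgebra k V where
  carrier := Model k V
  π := modelMap k V
  existsUnique_lift C _ _ _ g := by
    obtain ⟨ξ, hξ⟩ := exists_lift_model g
    exact ⟨ξ, hξ, fun ξ' h => modelMap_hom_ext (h.trans hξ.symm)⟩

end CofreeCoalgebra

/-! ### Measurings, elementwise -/

section MeasTensor

variable {k C C' R R' R'' : Type*} [Field k] [AddCommGroup C] [Module k C] [Coalgebra k C]
  [AddCommGroup C'] [Module k C'] [Coalgebra k C'] [AddCommGroup R] [Module k R]
  [AddCommGroup R'] [Module k R'] [AddCommGroup R''] [Module k R'']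

theorem measTensor_tmul (Ψ : C →ₗ[k] R →ₗ[k] R') (x : C) (u v : R) :
    measTensor Ψ x (u ⊗ₜ[k] v) =
      TensorProduct.map (Ψ.flip u) (Ψ.flip v) (Coalgebra.comul (R := k) x) := by
  simp only [measTensor, LinearMap.comp_apply]
  generalize Coalgebra.comul (R := k) x = w
  induction w with
  | zero => simp
  | tmul p q => simp
  | add p q hp hq => simp only [map_add, LinearMap.add_apply, hp, hq]

theorem measTensor_comp (Ψ : C →ₗ[k] R →ₗ[k] R') (ι : C' →ₗc[k] C) (x : C') :
    measTensor (Ψ ∘ₗ ι.toLinearMap) x = measTensor Ψ (ι x) := by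
  have h := LinearMap.congr_fun ι.map_comp_comul x
  simp only [LinearMap.comp_apply] at h
  simp only [measTensor, LinearMap.comp_apply, TensorProduct.map_comp]
  rw [h]
  rfl

/-- The coproduct of `x ⊗ y` is `(x₍₁₎ ⊗ y₍₁₎) ⊗ (x₍₂₎ ⊗ y₍₂₎)`, so the composites form leg by leg.
-/
theorem measTensor_compMeasuring (Ψ : C →ₗ[k] R →ₗ[k] R') (Ψ' : C' →ₗ[k] R' →ₗ[k] R'') (x : C)
    (y : C') : measTensor (compMeasuring Ψ Ψ') (x ⊗ₜ[k] y) =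
      measTensor Ψ' y ∘ₗ measTensor Ψ x := by
  simp only [measTensor, LinearMap.comp_apply, TensorProduct.comul_tmul]
  generalize Coalgebra.comul (R := k) x = w
  generalize Coalgebra.comul (R := k) y = z
  induction w with
  | zero => simp
  | add p q hp hq => simp only [map_add, TensorProduct.add_tmul, LinearMap.comp_add, hp, hq]
  | tmul p q =>
    induction z with
    | zero => simp
    | add p q hp hq => simp only [map_add, TensorProduct.tmul_add, LinearMap.add_comp, hp, hq]
    | tmul r s =>
      refine TensorProduct.ext' fun u v => ?_
      simp [compMeasuring_tmul]

theorem measTensor_field (Ψ : k →ₗ[k] R →ₗ[k] R') (c : k) :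
    measTensor Ψ c = c • TensorProduct.map (Ψ 1) (Ψ 1) := by
  refine TensorProduct.ext' fun u v => ?_
  have h : Ψ c = c • Ψ 1 := by rw [← map_smul, smul_eq_mul, mul_one]
  simp [measTensor_tmul, h, TensorProduct.smul_tmul']

end MeasTensor

namespace HopfAlgebroid

section

variable {k A U A' U' A'' U'' : Type*} [Field k]
  [Ring A] [Algebra k A] [Ring U] [Algebra k U]
  [Ring A'] [Algebra k A'] [Ring U'] [Algebra k U']
  [Ring A''] [Algebra k A''] [Ring U''] [Algebra k U'']

/-- The conditions that a measuring imposes on a single element `x` of the measuring coalgebra,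
in terms of the maps `F` and `f` by which `x` acts, the maps `F₂` and `f₂` by which `x₍₁₎ ⊗ x₍₂₎`
acts, and the value `e` of the counit at `x`. -/
structure IsMeasuringDatum (H : HopfAlgebroid k A U) (H' : HopfAlgebroid k A' U')
    (F : U →ₗ[k] U') (f : A →ₗ[k] A') (F₂ : (U ⊗[k] U) →ₗ[k] (U' ⊗[k] U'))
    (f₂ : (A ⊗[k] A) →ₗ[k] (A' ⊗[k] A')) (e : k) : Prop where
  total_mul : ∀ w, F (LinearMap.mul' k U w) = LinearMap.mul' k U' (F₂ w)
  total_one : F 1 = e • 1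
  base_mul : ∀ w, f (LinearMap.mul' k A w) = LinearMap.mul' k A' (f₂ w)
  base_one : f 1 = e • 1
  source : ∀ a, F (H.s a) = H'.s (f a)
  target : ∀ a, F (H.t (op a)) = H'.t (op (f a))
  antipode : ∀ u, F (H.S u) = H'.S (F u)
  counit : ∀ u, f (H.ε u) = H'.ε (F u)
  comul : ∀ u w, H.cls w = H.Δ u → H'.Δ (F u) = H'.cls (F₂ w)

namespace IsMeasuringDatum

variable {H : HopfAlgebroid k A U} {H' : HopfAlgebroid k A' U'} {H'' : HopfAlgebroid k A'' U''}
  {F G : U →ₗ[k] U'} {f g : A →ₗ[k] A'} {F₂ G₂ : (U ⊗[k] U) →ₗ[k] (U' ⊗[k] U')}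
  {f₂ g₂ : (A ⊗[k] A) →ₗ[k] (A' ⊗[k] A')} {e d : k}

/-- Because `F₂`, `f₂` and `e` are arguments independent of `F` and `f`, conditions that look
quadratic are linear in the whole tuple. This lemma and the next two record it. -/
theorem zero : IsMeasuringDatum H H' 0 0 0 0 0 := by
  constructor <;> simp

theorem add (h : IsMeasuringDatum H H' F f F₂ f₂ e) (h' : IsMeasuringDatum H H' G g G₂ g₂ d) :
    IsMeasuringDatum H H' (F + G) (f + g) (F₂ + G₂) (f₂ + g₂) (e + d) where
  total_mul w := by simp [h.total_mul, h'.total_mul]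
  total_one := by simp [h.total_one, h'.total_one, add_smul]
  base_mul w := by simp [h.base_mul, h'.base_mul]
  base_one := by simp [h.base_one, h'.base_one, add_smul]
  source a := by simp [h.source, h'.source]
  target a := by simp [h.target, h'.target]
  antipode a := by simp [h.antipode, h'.antipode]
  counit a := by simp [h.counit, h'.counit]
  comul u w hw := by simp [h.comul u w hw, h'.comul u w hw]

theorem smul (c : k) (h : IsMeasuringDatum H H' F f F₂ f₂ e) :
    IsMeasuringDatum H H' (c • F) (c • f) (c • F₂) (c • f₂) (c * e) where
  total_mul w := by simp [h.total_mul]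
  total_one := by simp [h.total_one, mul_smul]
  base_mul w := by simp [h.base_mul]
  base_one := by simp [h.base_one, mul_smul]
  source a := by simp [h.source]
  target a := by simp [h.target]
  antipode a := by simp [h.antipode]
  counit a := by simp [h.counit]
  comul u w hw := by simp [h.comul u w hw]

theorem comp {F' : U' →ₗ[k] U''} {f' : A' →ₗ[k] A''} {F₂' : (U' ⊗[k] U') →ₗ[k] (U'' ⊗[k] U'')}
    {f₂' : (A' ⊗[k] A') →ₗ[k] (A'' ⊗[k] A'')} (h' : IsMeasuringDatum H' H'' F' f' F₂' f₂' d)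
    (h : IsMeasuringDatum H H' F f F₂ f₂ e) :
    IsMeasuringDatum H H'' (F' ∘ₗ F) (f' ∘ₗ f) (F₂' ∘ₗ F₂) (f₂' ∘ₗ f₂) (d * e) where
  total_mul w := by simp [h.total_mul, h'.total_mul]
  total_one := by simp [h.total_one, h'.total_one, mul_comm d e, mul_smul]
  base_mul w := by simp [h.base_mul, h'.base_mul]
  base_one := by simp [h.base_one, h'.base_one, mul_comm d e, mul_smul]
  source a := by simp [h.source, h'.source]
  target a := by simp [h.target, h'.target]
  antipode a := by simp [h.antipode, h'.antipode]
  counit a := by simp [h.counit, h'.counit]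
  -- `F₂ w` represents the coproduct of `F u`; quantifying over all representatives lets the two
  -- conditions chain without `F₂` descending to the balanced tensor product.
  comul u w hw := h'.comul _ _ (h.comul u w hw).symm

/-- An element acting by `F` and `f` whose coproduct is its square is a morphism. -/
def toHom (h : IsMeasuringDatum H H' F f (TensorProduct.map F F) (TensorProduct.map f f) 1) :
    H.Hom H' where
  F := AlgHom.ofLinearMap F (by simpa using h.total_one)
    fun x y => by simpa using h.total_mul (x ⊗ₜ y)
  f := AlgHom.ofLinearMap f (by simpa using h.base_one)
    fun x y => by simpa using h.base_mul (x ⊗ₜ y)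
  source := h.source
  target := h.target
  comul u := by
    obtain ⟨w, hw⟩ := H.cls_surjective (H.Δ u)
    rw [← hw]
    exact h.comul u w hw
  counit := h.counit
  antipode u := (h.antipode u).symm

end IsMeasuringDatum

theorem Hom.isMeasuringDatum {H : HopfAlgebroid k A U} {H' : HopfAlgebroid k A' U'}
    (g : H.Hom H') : IsMeasuringDatum H H' g.F.toLinearMap g.f.toLinearMap
      (TensorProduct.map g.F.toLinearMap g.F.toLinearMap)
      (TensorProduct.map g.f.toLinearMap g.f.toLinearMap) 1 where
  total_mul w := by
    induction w with
    | zero => simp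
    | tmul x y => simp
    | add x y hx hy => simp only [map_add, hx, hy]
  total_one := by simp
  base_mul w := by
    induction w with
    | zero => simp
    | tmul x y => simp
    | add x y hx hy => simp only [map_add, hx, hy]
  base_one := by simp
  source := g.source
  target := g.target
  antipode u := (g.antipode u).symm
  counit := g.counit
  comul u w hw := by
    refine (g.comul u).trans ?_
    rw [← hw]
    rfl

end

section

variable {k C C' A U A' U' A'' U'' : Type*} [Field k]
  [AddCommGroup C] [Module k C] [Coalgebra k C] [AddCommGroup C'] [Module k C'] [Coalgebra k C']
  [Ring A] [Algebra k A] [Ring U] [Algebra k U]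
  [Ring A'] [Algebra k A'] [Ring U'] [Algebra k U']
  [Ring A''] [Algebra k A''] [Ring U''] [Algebra k U'']
  {H : HopfAlgebroid k A U} {H' : HopfAlgebroid k A' U'} {H'' : HopfAlgebroid k A'' U''}

variable (H H') in
/-- The elements of a coalgebra at which a pair of maps satisfies the conditions of a measuring. -/
def measuringLocus (Ψ : C →ₗ[k] U →ₗ[k] U') (ψ : C →ₗ[k] A →ₗ[k] A') : Submodule k C where
  carrier := {x | IsMeasuringDatum H H' (Ψ x) (ψ x) (measTensor Ψ x) (measTensor ψ x)
    (Coalgebra.counit x)}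
  zero_mem' := by simpa using IsMeasuringDatum.zero
  add_mem' hx hy := by simpa using IsMeasuringDatum.add hx hy
  smul_mem' c x hx := by simpa using IsMeasuringDatum.smul c hx

theorem mem_measuringLocus {Ψ : C →ₗ[k] U →ₗ[k] U'} {ψ : C →ₗ[k] A →ₗ[k] A'} {x : C} :
    x ∈ measuringLocus H H' Ψ ψ ↔ IsMeasuringDatum H H' (Ψ x) (ψ x) (measTensor Ψ x)
      (measTensor ψ x) (Coalgebra.counit x) :=
  Iff.rfl

theorem IsAlgMeasuring.map_mul' {Ψ : C →ₗ[k] U →ₗ[k] U'} (h : IsAlgMeasuring Ψ) (x : C)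
    (w : U ⊗[k] U) :
    Ψ x (LinearMap.mul' k U w) = LinearMap.mul' k U' (measTensor Ψ x w) := by
  induction w with
  | zero => simp
  | tmul u v => rw [LinearMap.mul'_apply, h.map_mul, measTensor_tmul]
  | add x y hx hy => simp only [map_add, hx, hy]

/-- Being a measuring is a condition on single elements. Cocommutativity serves only to make the map
on balanced tensors well defined, so the locus itself makes sense in the cofree coalgebra, where
cocommutativity is not assumed. -/
theorem isMeasuring_iff [Coalgebra.IsCocomm k C] {Ψ : C →ₗ[k] U →ₗ[k] U'}
    {ψ : C →ₗ[k] A →ₗ[k] A'} :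
    IsMeasuring H H' Ψ ψ ↔ ∀ x, x ∈ measuringLocus H H' Ψ ψ := by
  constructor
  · intro h x
    exact
      { total_mul := IsAlgMeasuring.map_mul' h.total x
        total_one := h.total.map_one x
        base_mul := IsAlgMeasuring.map_mul' h.base x
        base_one := h.base.map_one x
        source := h.source x
        target := h.target x
        antipode := h.antipode x
        counit := h.counit x
        comul := fun u w hw => by
          rw [h.comul, ← hw]
          rfl }
  · intro h
    have h' := fun x => mem_measuringLocus.1 (h x)
    refine { total := ⟨fun x a b => ?_, fun x => (h' x).total_one⟩
             base := ⟨fun x a b => ?_, fun x => (h' x).base_one⟩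
             source := fun x => (h' x).source
             target := fun x => (h' x).target
             antipode := fun x => (h' x).antipode
             counit := fun x => (h' x).counit
             comul := fun x u => ?_ }
    · rw [← measTensor_tmul, ← (h' x).total_mul, LinearMap.mul'_apply]
    · rw [← measTensor_tmul, ← (h' x).base_mul, LinearMap.mul'_apply]
    · obtain ⟨w, hw⟩ := H.cls_surjective (H.Δ u)
      rw [(h' x).comul u w hw, ← hw]
      rfl

/-- Coalgebra maps preserve coproduct and counit, so the data at `x` and at `ι x` coincide. This
moves the measuring conditions between a coalgebra, its image and the ambient cofree coalgebra. -/
theorem mem_measuringLocus_comp {Ψ : C →ₗ[k] U →ₗ[k] U'} {ψ : C →ₗ[k] A →ₗ[k] A'}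
    (ι : C' →ₗc[k] C) (x : C') :
    x ∈ measuringLocus H H' (Ψ ∘ₗ ι.toLinearMap) (ψ ∘ₗ ι.toLinearMap) ↔
      ι x ∈ measuringLocus H H' Ψ ψ := by
  have h := LinearMap.congr_fun ι.counit_comp x
  rw [LinearMap.comp_apply] at h
  rw [mem_measuringLocus, mem_measuringLocus, measTensor_comp, measTensor_comp, ← h]
  rfl

theorem IsMeasuring.comp [Coalgebra.IsCocomm k C] [Coalgebra.IsCocomm k C']
    {Ψ : C →ₗ[k] U →ₗ[k] U'} {ψ : C →ₗ[k] A →ₗ[k] A'}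
    {Ψ' : C' →ₗ[k] U' →ₗ[k] U''} {ψ' : C' →ₗ[k] A' →ₗ[k] A''}
    (h : IsMeasuring H H' Ψ ψ) (h' : IsMeasuring H' H'' Ψ' ψ') :
    IsMeasuring H H'' (compMeasuring Ψ Ψ') (compMeasuring ψ ψ') := by
  rw [isMeasuring_iff] at h h' ⊢
  intro z
  -- The locus is a subspace, so pure tensors suffice.
  induction z with
  | zero => exact Submodule.zero_mem _
  | add x y hx hy => exact Submodule.add_mem _ hx hy
  | tmul x y =>
    rw [mem_measuringLocus, measTensor_compMeasuring, measTensor_compMeasuring]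
    exact IsMeasuringDatum.comp (h' y) (h x)

theorem Hom.isMeasuring (g : H.Hom H') :
    IsMeasuring H H' (LinearMap.toSpanSingleton k _ g.F.toLinearMap)
      (LinearMap.toSpanSingleton k _ g.f.toLinearMap) := by
  rw [isMeasuring_iff]
  intro c
  rw [mem_measuringLocus, measTensor_field, measTensor_field]
  simpa using g.isMeasuringDatum.smul c

/-- The element `1` of `k` is grouplike, so its coproduct acts by tensor squares; the datum obtained
has exactly the form that `toHom` turns into a morphism. -/
theorem IsMeasuring.isMeasuringDatum_one {Ψ : k →ₗ[k] U →ₗ[k] U'} {ψ : k →ₗ[k] A →ₗ[k] A'}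
    (h : IsMeasuring H H' Ψ ψ) : IsMeasuringDatum H H' (Ψ 1) (ψ 1)
      (TensorProduct.map (Ψ 1) (Ψ 1)) (TensorProduct.map (ψ 1) (ψ 1)) 1 := by
  simpa [mem_measuringLocus, measTensor_field] using isMeasuring_iff.1 h 1

end

end HopfAlgebroid

/-! ### Images and corestrictions of coalgebra maps. -/

namespace Subcoalgebra

variable {k C D : Type*} [Field k] [AddCommGroup C] [Module k C] [Coalgebra k C]
  [AddCommGroup D] [Module k D] [Coalgebra k D]

/-- The image of a coalgebra map. -/
def range (f : C →ₗc[k] D) : Subcoalgebra k D where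
  toSubmodule := LinearMap.range f.toLinearMap
  comul_mem := by
    rintro _ ⟨c, rfl⟩
    have h := LinearMap.congr_fun f.map_comp_comul c
    rw [LinearMap.comp_apply, LinearMap.comp_apply] at h
    refine ⟨TensorProduct.map f.toLinearMap.rangeRestrict f.toLinearMap.rangeRestrict
      (Coalgebra.comul (R := k) c), ?_⟩
    rw [TensorProduct.map_map, ← h]
    rfl

theorem isCocomm_range (f : C →ₗc[k] D) [Coalgebra.IsCocomm k C] :
    Coalgebra.IsCocomm k (range f).toSubmodule := by
  rw [isCocomm_iff]
  rintro _ ⟨c, rfl⟩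
  have h := LinearMap.congr_fun f.map_comp_comul c
  rw [LinearMap.comp_apply, LinearMap.comp_apply] at h
  rw [← h, ← TensorProduct.map_comm, Coalgebra.comm_comul]

/-- A coalgebra map with values in a subcoalgebra, as a coalgebra map to the subcoalgebra. -/
noncomputable def codRestrict (E : Subcoalgebra k D) (f : C →ₗc[k] D)
    (h : ∀ c, f c ∈ E.toSubmodule) : C →ₗc[k] E.toSubmodule where
  __ := f.toLinearMap.codRestrict E.toSubmodule h
  counit_comp := f.counit_comp
  map_comp_comul := by
    ext1 c
    -- Compatibility with coproducts is tested in the ambient tensor square, where it is that of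
    -- `f`.
    refine E.incl₂_injective ?_
    rw [LinearMap.comp_apply, LinearMap.comp_apply, incl₂_comul, TensorProduct.map_map]
    exact LinearMap.congr_fun f.map_comp_comul c

end Subcoalgebra

/-! ### The universal property -/

namespace HAlg

variable {k : Type u} [Field k] {X Y : HAlg k} (K : CofreeCoalgebra k (V X Y))

/-- The inclusion of `M_c(X, Y)` into the cofree coalgebra. -/
noncomputable def McIncl : (Mc K).obj →ₗc[k] K.carrier := (measuringSum K).incl

theorem McIncl_injective : Function.Injective (McIncl K) := Subtype.val_injective

theorem totalPart_comp_McIncl :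
    HopfAlgebroid.totalPart K.π ∘ₗ (McIncl K).toLinearMap = McTotal K :=
  rfl

theorem basePart_comp_McIncl :
    HopfAlgebroid.basePart K.π ∘ₗ (McIncl K).toLinearMap = McBase K :=
  rfl

/-- The locus of `K.π` in the whole cofree coalgebra is a subspace containing every measuring
subcoalgebra, hence their sum. -/
theorem isMeasuring_Mc : HopfAlgebroid.IsMeasuring X.str Y.str (McTotal K) (McBase K) := by
  have key : (measuringSum K).toSubmodule ≤ HopfAlgebroid.measuringLocus X.str Y.str
      (HopfAlgebroid.totalPart K.π) (HopfAlgebroid.basePart K.π) := by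
    refine iSup₂_le fun D hD x hx => ?_
    obtain ⟨_, h⟩ := hD
    exact (HopfAlgebroid.mem_measuringLocus_comp D.incl ⟨x, hx⟩).1
      (HopfAlgebroid.isMeasuring_iff.1 h ⟨x, hx⟩)
  rw [HopfAlgebroid.isMeasuring_iff]
  intro x
  rw [← totalPart_comp_McIncl, ← basePart_comp_McIncl, HopfAlgebroid.mem_measuringLocus_comp]
  exact key x.2

section

variable {K} {C : Type u} [AddCommGroup C] [Module k C] [Coalgebra k C]

/-- After the injective inclusion into the cofree coalgebra this is uniqueness of lifts, the map to
`V X Y` being determined by its two components. All later identities between maps into `Mc` rest on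
it. -/
theorem Mc_hom_ext {ξ ξ' : C →ₗc[k] (Mc K).obj}
    (h : McTotal K ∘ₗ ξ.toLinearMap = McTotal K ∘ₗ ξ'.toLinearMap)
    (h' : McBase K ∘ₗ ξ.toLinearMap = McBase K ∘ₗ ξ'.toLinearMap) : ξ = ξ' := by
  have e : (McIncl K).comp ξ = (McIncl K).comp ξ' := by
    refine (K.existsUnique_lift C (K.π ∘ₗ ((McIncl K).comp ξ).toLinearMap)).unique rfl ?_
    refine LinearMap.ext fun c => Subtype.ext (Prod.ext ?_ ?_)
    · exact (LinearMap.congr_fun h c).symm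
    · exact (LinearMap.congr_fun h' c).symm
  refine CoalgHom.ext fun c => McIncl_injective K ?_
  exact DFunLike.congr_fun e c

/-- The image of the cofree lift is one of the subcoalgebras being summed, so the lift corestricts
to the sum. -/
theorem exists_lift_Mc [Coalgebra.IsCocomm k C] {Ψ : C →ₗ[k] X.U →ₗ[k] Y.U}
    {ψ : C →ₗ[k] X.A →ₗ[k] Y.A} (h : HopfAlgebroid.IsMeasuring X.str Y.str Ψ ψ) :
    ∃ ξ : C →ₗc[k] (Mc K).obj,
      McTotal K ∘ₗ ξ.toLinearMap = Ψ ∧ McBase K ∘ₗ ξ.toLinearMap = ψ := by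
  let θ : C →ₗ[k] V X Y := (Ψ.prod ψ).codRestrict (V X Y)
    fun c => ⟨h.source c, h.target c, h.antipode c, h.counit c⟩
  obtain ⟨ζ, hζ, -⟩ := K.existsUnique_lift C θ
  have hΨ : HopfAlgebroid.totalPart K.π ∘ₗ ζ.toLinearMap = Ψ := by
    change HopfAlgebroid.totalPart (K.π ∘ₗ ζ.toLinearMap) = Ψ
    rw [hζ]
    rfl
  have hψ : HopfAlgebroid.basePart K.π ∘ₗ ζ.toLinearMap = ψ := by
    change HopfAlgebroid.basePart (K.π ∘ₗ ζ.toLinearMap) = ψ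
    rw [hζ]
    rfl
  have hD : Subcoalgebra.range ζ ∈ measuringSubcoalgebras K := by
    have := Subcoalgebra.isCocomm_range ζ
    refine ⟨this, HopfAlgebroid.isMeasuring_iff.2 ?_⟩
    rintro ⟨_, c, rfl⟩
    -- Two transfers: from the image up to the cofree coalgebra along the inclusion, then back to
    -- `C` along `ζ`.
    refine (HopfAlgebroid.mem_measuringLocus_comp (Ψ := HopfAlgebroid.totalPart K.π)
      (ψ := HopfAlgebroid.basePart K.π) (Subcoalgebra.range ζ).incl _).2 ?_
    refine (HopfAlgebroid.mem_measuringLocus_comp ζ c).1 ?_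
    rw [hΨ, hψ]
    exact HopfAlgebroid.isMeasuring_iff.1 h c
  have hle : (Subcoalgebra.range ζ).toSubmodule ≤ (measuringSum K).toSubmodule :=
    le_iSup₂_of_le (f := fun D (_ : D ∈ measuringSubcoalgebras K) => D.toSubmodule) _ hD le_rfl
  exact ⟨(measuringSum K).codRestrict ζ fun c => hle ⟨c, rfl⟩, hΨ, hψ⟩

end

end HAlg

/-! ### The enriched category -/

namespace HAlg

variable {k : Type u} [Field k]

instance (C : CoCoalg k) : Coalgebra.IsCocomm k C.obj := C.property

section

variable {X Y Z : HAlg k} (K : CofreeCoalgebra k (V X Y)) (L : CofreeCoalgebra k (V Y Z))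
  (N : CofreeCoalgebra k (V X Z))

variable {K} in
theorem Mc_hom_ext' {C : CoCoalg k} {ξ ξ' : C ⟶ Mc K}
    (h : McTotal K ∘ₗ CoCoalg.lin ξ = McTotal K ∘ₗ CoCoalg.lin ξ')
    (h' : McBase K ∘ₗ CoCoalg.lin ξ = McBase K ∘ₗ CoCoalg.lin ξ') : ξ = ξ' :=
  ObjectProperty.hom_ext _ (CoalgCat.hom_ext _ _ (Mc_hom_ext h h'))

theorem exists_McHom (C : CoCoalg k) {Ψ : C.obj →ₗ[k] X.U →ₗ[k] Y.U}
    {ψ : C.obj →ₗ[k] X.A →ₗ[k] Y.A} (h : HopfAlgebroid.IsMeasuring X.str Y.str Ψ ψ) :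
    ∃ ξ : C ⟶ Mc K, McTotal K ∘ₗ CoCoalg.lin ξ = Ψ ∧ McBase K ∘ₗ CoCoalg.lin ξ = ψ := by
  obtain ⟨ξ, h₁, h₂⟩ := exists_lift_Mc (K := K) h
  exact ⟨ObjectProperty.homMk (CoalgCat.ofHom ξ), h₁, h₂⟩

theorem exists_McComp : ∃ ξ : Mc K ⊗ Mc L ⟶ Mc N,
    McTotal N ∘ₗ CoCoalg.lin ξ = compMeasuring (McTotal K) (McTotal L) ∧
    McBase N ∘ₗ CoCoalg.lin ξ = compMeasuring (McBase K) (McBase L) :=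
  exists_McHom N (Mc K ⊗ Mc L) ((isMeasuring_Mc K).comp (isMeasuring_Mc L))

/-- The composition of the enriched category of Hopf algebroids. -/
noncomputable def McComp : Mc K ⊗ Mc L ⟶ Mc N :=
  (exists_McComp K L N).choose

theorem McTotal_McComp : McTotal N ∘ₗ CoCoalg.lin (McComp K L N) =
    compMeasuring (McTotal K) (McTotal L) :=
  (exists_McComp K L N).choose_spec.1

theorem McBase_McComp : McBase N ∘ₗ CoCoalg.lin (McComp K L N) =
    compMeasuring (McBase K) (McBase L) :=
  (exists_McComp K L N).choose_spec.2

theorem McTotal_McComp_tmul (x : (Mc K).obj) (y : (Mc L).obj) :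
    McTotal N (CoCoalg.lin (McComp K L N) (x ⊗ₜ[k] y)) = McTotal L y ∘ₗ McTotal K x :=
  LinearMap.congr_fun (McTotal_McComp K L N) (x ⊗ₜ[k] y)

theorem McBase_McComp_tmul (x : (Mc K).obj) (y : (Mc L).obj) :
    McBase N (CoCoalg.lin (McComp K L N) (x ⊗ₜ[k] y)) = McBase L y ∘ₗ McBase K x :=
  LinearMap.congr_fun (McBase_McComp K L N) (x ⊗ₜ[k] y)

theorem exists_McPoint (g : X ⟶ Y) : ∃ ξ : 𝟙_ (CoCoalg k) ⟶ Mc K,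
    McTotal K ∘ₗ CoCoalg.lin ξ = LinearMap.toSpanSingleton k _ g.F.toLinearMap ∧
    McBase K ∘ₗ CoCoalg.lin ξ = LinearMap.toSpanSingleton k _ g.f.toLinearMap :=
  exists_McHom K (𝟙_ (CoCoalg k)) (HopfAlgebroid.Hom.isMeasuring g)

/-- The point of `M_c(X, Y)` given by a morphism of Hopf algebroids. -/
noncomputable def McPoint (g : X ⟶ Y) : 𝟙_ (CoCoalg k) ⟶ Mc K :=
  (exists_McPoint K g).choose

theorem McTotal_McPoint (g : X ⟶ Y) : McTotal K ∘ₗ CoCoalg.lin (McPoint K g) =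
    LinearMap.toSpanSingleton k _ g.F.toLinearMap :=
  (exists_McPoint K g).choose_spec.1

theorem McBase_McPoint (g : X ⟶ Y) : McBase K ∘ₗ CoCoalg.lin (McPoint K g) =
    LinearMap.toSpanSingleton k _ g.f.toLinearMap :=
  (exists_McPoint K g).choose_spec.2

theorem McTotal_McPoint_apply (g : X ⟶ Y) (c : k) :
    McTotal K (CoCoalg.lin (McPoint K g) c) = c • g.F.toLinearMap :=
  LinearMap.congr_fun (McTotal_McPoint K g) c

theorem McBase_McPoint_apply (g : X ⟶ Y) (c : k) :
    McBase K (CoCoalg.lin (McPoint K g) c) = c • g.f.toLinearMap :=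
  LinearMap.congr_fun (McBase_McPoint K g) c

variable {K} in
/-- The restriction of the universal measuring along a point is a measuring by `k`. -/
theorem isMeasuring_point (ξ : 𝟙_ (CoCoalg k) ⟶ Mc K) :
    HopfAlgebroid.IsMeasuring (C := k) X.str Y.str (McTotal K ∘ₗ CoCoalg.lin ξ)
      (McBase K ∘ₗ CoCoalg.lin ξ) := by
  rw [HopfAlgebroid.isMeasuring_iff]
  intro c
  exact (HopfAlgebroid.mem_measuringLocus_comp (C' := k) (ξ.hom.toCoalgHom) c).2
    (HopfAlgebroid.isMeasuring_iff.1 (isMeasuring_Mc K) _)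

/-- Morphisms of Hopf algebroids are the points of `M_c(X, Y)`. -/
noncomputable def McPointEquiv : (X ⟶ Y) ≃ (𝟙_ (CoCoalg k) ⟶ Mc K) where
  toFun := McPoint K
  -- The morphism by which the image of `1` acts.
  invFun ξ := (isMeasuring_point ξ).isMeasuringDatum_one.toHom
  left_inv g := by
    refine HopfAlgebroid.Hom.ext ?_ ?_
    · refine AlgHom.ext fun u => ?_
      exact (LinearMap.congr_fun (McTotal_McPoint_apply K g 1) u).trans (one_smul k _)
    · refine AlgHom.ext fun a => ?_
      exact (LinearMap.congr_fun (McBase_McPoint_apply K g 1) a).trans (one_smul k _)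
  right_inv ξ := by
    refine Mc_hom_ext' ?_ ?_
    · rw [McTotal_McPoint]
      refine LinearMap.ext_ring ?_
      exact one_smul k _
    · rw [McBase_McPoint]
      refine LinearMap.ext_ring ?_
      exact one_smul k _

end

/-- The category of Hopf algebroids, enriched over cocommutative coalgebras. -/
noncomputable abbrev enriched (𝒞 : ∀ X Y : HAlg k, CofreeCoalgebra k (V X Y)) :
    EnrichedCategory (CoCoalg k) (HAlg k) where
  Hom X Y := Mc (𝒞 X Y)
  id X := McPoint (𝒞 X X) (𝟙 X)
  comp X Y Z := McComp (𝒞 X Y) (𝒞 Y Z) (𝒞 X Z)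
  id_comp X Y := by
    refine Mc_hom_ext' ?_ ?_
    · refine LinearMap.ext fun x => ?_
      -- The inverse unitor sends `x` to `1 ⊗ x`.
      change McTotal _ (CoCoalg.lin (McComp _ _ _)
        (CoCoalg.lin (McPoint _ _) (1 : k) ⊗ₜ[k] x)) = McTotal _ x
      rw [McTotal_McComp_tmul, McTotal_McPoint_apply, one_smul]
      rfl
    · refine LinearMap.ext fun x => ?_
      change McBase _ (CoCoalg.lin (McComp _ _ _)
        (CoCoalg.lin (McPoint _ _) (1 : k) ⊗ₜ[k] x)) = McBase _ x
      rw [McBase_McComp_tmul, McBase_McPoint_apply, one_smul]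
      rfl
  comp_id X Y := by
    refine Mc_hom_ext' ?_ ?_
    · refine LinearMap.ext fun x => ?_
      change McTotal _ (CoCoalg.lin (McComp _ _ _)
        (x ⊗ₜ[k] CoCoalg.lin (McPoint _ _) (1 : k))) = McTotal _ x
      rw [McTotal_McComp_tmul, McTotal_McPoint_apply, one_smul]
      rfl
    · refine LinearMap.ext fun x => ?_
      change McBase _ (CoCoalg.lin (McComp _ _ _)
        (x ⊗ₜ[k] CoCoalg.lin (McPoint _ _) (1 : k))) = McBase _ x
      rw [McBase_McComp_tmul, McBase_McPoint_apply, one_smul]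
      rfl
  assoc W X Y Z := by
    refine Mc_hom_ext' ?_ ?_
    · refine TensorProduct.ext <| LinearMap.ext fun x => TensorProduct.ext' fun y z => ?_
      -- On `x ⊗ (y ⊗ z)` both sides act by the triple composite of linear maps.
      change McTotal _ (CoCoalg.lin (McComp _ _ _)
        (CoCoalg.lin (McComp (𝒞 W X) (𝒞 X Y) (𝒞 W Y)) (x ⊗ₜ[k] y) ⊗ₜ[k] z)) =
        McTotal _ (CoCoalg.lin (McComp _ _ _)
          (x ⊗ₜ[k] CoCoalg.lin (McComp (𝒞 X Y) (𝒞 Y Z) (𝒞 X Z)) (y ⊗ₜ[k] z)))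
      rw [McTotal_McComp_tmul, McTotal_McComp_tmul, McTotal_McComp_tmul, McTotal_McComp_tmul]
      rfl
    · refine TensorProduct.ext <| LinearMap.ext fun x => TensorProduct.ext' fun y z => ?_
      change McBase _ (CoCoalg.lin (McComp _ _ _)
        (CoCoalg.lin (McComp (𝒞 W X) (𝒞 X Y) (𝒞 W Y)) (x ⊗ₜ[k] y) ⊗ₜ[k] z)) =
        McBase _ (CoCoalg.lin (McComp _ _ _)
          (x ⊗ₜ[k] CoCoalg.lin (McComp (𝒞 X Y) (𝒞 Y Z) (𝒞 X Z)) (y ⊗ₜ[k] z)))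
      rw [McBase_McComp_tmul, McBase_McComp_tmul, McBase_McComp_tmul, McBase_McComp_tmul]
      rfl

/-- The category of Hopf algebroids is the underlying category of its enrichment. -/
noncomputable abbrev enrichedOrdinary (𝒞 : ∀ X Y : HAlg k, CofreeCoalgebra k (V X Y)) :
    EnrichedOrdinaryCategory (CoCoalg k) (HAlg k) where
  __ := enriched 𝒞
  homEquiv {X Y} := McPointEquiv (𝒞 X Y)
  homEquiv_id X := rfl
  homEquiv_comp {X Y Z} f g := by
    refine Mc_hom_ext' ?_ ?_
    -- Linear maps out of `k` are compared at `1`, which the inverse unitor sends to `1 ⊗ 1`.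
    · refine LinearMap.ext_ring ?_
      change McTotal _ (CoCoalg.lin (McPoint _ _) (1 : k)) =
        McTotal _ (CoCoalg.lin (McComp (𝒞 X Y) (𝒞 Y Z) (𝒞 X Z))
          (CoCoalg.lin (McPoint _ f) (1 : k) ⊗ₜ[k] CoCoalg.lin (McPoint _ g) (1 : k)))
      rw [McTotal_McComp_tmul, McTotal_McPoint_apply, McTotal_McPoint_apply,
        McTotal_McPoint_apply, one_smul, one_smul, one_smul]
      rfl
    · refine LinearMap.ext_ring ?_
      change McBase _ (CoCoalg.lin (McPoint _ _) (1 : k)) =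
        McBase _ (CoCoalg.lin (McComp (𝒞 X Y) (𝒞 Y Z) (𝒞 X Z))
          (CoCoalg.lin (McPoint _ f) (1 : k) ⊗ₜ[k] CoCoalg.lin (McPoint _ g) (1 : k)))
      rw [McBase_McComp_tmul, McBase_McPoint_apply, McBase_McPoint_apply,
        McBase_McPoint_apply, one_smul, one_smul, one_smul]
      rfl

end HAlg

/-! ### Assembly of the theorem. -/

theorem theorem2p7 (k : Type u) [Field k] :
    -- cofree coalgebras exist
    (∀ (V : Type u) [AddCommGroup V] [Module k V], Nonempty (CofreeCoalgebra k V)) ∧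
    -- fix a cofree coalgebra on `V(X, Y)` for all Hopf algebroids `X`, `Y`
    ∀ 𝒞 : (∀ X Y : HAlg k, CofreeCoalgebra k (HAlg.V X Y)),
      -- `M_c(X, Y)` with `(Φ, φ)` is the universal cocommutative measuring coalgebra
      (∀ X Y : HAlg k,
        HopfAlgebroid.IsMeasuring X.str Y.str (HAlg.McTotal (𝒞 X Y)) (HAlg.McBase (𝒞 X Y)) ∧
        ∀ (C : Type u) [AddCommGroup C] [Module k C] [Coalgebra k C] [Coalgebra.IsCocomm k C]
          (Ψ : C →ₗ[k] X.U →ₗ[k] Y.U) (ψ : C →ₗ[k] X.A →ₗ[k] Y.A),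
          HopfAlgebroid.IsMeasuring X.str Y.str Ψ ψ →
          ∃! ξ : C →ₗc[k] (HAlg.Mc (𝒞 X Y)).obj,
            HAlg.McTotal (𝒞 X Y) ∘ₗ ξ.toLinearMap = Ψ ∧
            HAlg.McBase (𝒞 X Y) ∘ₗ ξ.toLinearMap = ψ) ∧
      -- the composites of the universal measurings are measurings
      (∀ X Y Z : HAlg k, HopfAlgebroid.IsMeasuring X.str Z.str
        (compMeasuring (HAlg.McTotal (𝒞 X Y)) (HAlg.McTotal (𝒞 Y Z)))
        (compMeasuring (HAlg.McBase (𝒞 X Y)) (HAlg.McBase (𝒞 Y Z)))) ∧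
      -- `t ↦ (t · id, t · id)` is a measuring
      (∀ X : HAlg k, HopfAlgebroid.IsMeasuring X.str X.str
        (unitMeasuring k X.U) (unitMeasuring k X.A)) ∧
      -- the category of Hopf algebroids is enriched over cocommutative coalgebras, with hom-objects
      -- `M_c(X, Y)`, and with composition and unit induced by the two previous measurings
      ∃ (E : EnrichedOrdinaryCategory (CoCoalg k) (HAlg k))
        (h : ∀ X Y : HAlg k, E.toEnrichedCategory.Hom X Y = HAlg.Mc (𝒞 X Y)),
        (∀ X Y Z : HAlg k,
          HAlg.McTotal (𝒞 X Z) ∘ₗ CoCoalg.lin (E.toEnrichedCategory.comp X Y Z ≫ eqToHom (h X Z)) =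
            compMeasuring (HAlg.McTotal (𝒞 X Y)) (HAlg.McTotal (𝒞 Y Z)) ∘ₗ
              CoCoalg.lin (eqToHom (h X Y) ⊗ₘ eqToHom (h Y Z)) ∧
          HAlg.McBase (𝒞 X Z) ∘ₗ CoCoalg.lin (E.toEnrichedCategory.comp X Y Z ≫ eqToHom (h X Z)) =
            compMeasuring (HAlg.McBase (𝒞 X Y)) (HAlg.McBase (𝒞 Y Z)) ∘ₗ
              CoCoalg.lin (eqToHom (h X Y) ⊗ₘ eqToHom (h Y Z))) ∧
        (∀ X : HAlg k,
          HAlg.McTotal (𝒞 X X) ∘ₗ CoCoalg.lin (E.toEnrichedCategory.id X ≫ eqToHom (h X X)) =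
            unitMeasuring k X.U ∧
          HAlg.McBase (𝒞 X X) ∘ₗ CoCoalg.lin (E.toEnrichedCategory.id X ≫ eqToHom (h X X)) =
            unitMeasuring k X.A) ∧
        -- a morphism `g = (F, f)` corresponds to the measuring `t ↦ (t · F, t · f)` by `k`
        (∀ (X Y : HAlg k) (g : X ⟶ Y) (c : k),
          HAlg.McTotal (𝒞 X Y) (CoCoalg.lin (E.homEquiv g ≫ eqToHom (h X Y)) c) =
            c • g.F.toLinearMap ∧
          HAlg.McBase (𝒞 X Y) (CoCoalg.lin (E.homEquiv g ≫ eqToHom (h X Y)) c) =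
            c • g.f.toLinearMap) := by
  -- The hom-objects of `enrichedOrdinary` are the `Mc` by definition, so `rfl` proves the
  -- equalities and the `eqToHom` are identities. The unit measuring is that of the identity
  -- morphism.
  refine ⟨fun V _ _ => ⟨CofreeCoalgebra.model k V⟩, fun 𝒞 => ⟨fun X Y => ⟨HAlg.isMeasuring_Mc _, ?_⟩,
    fun X Y Z => (HAlg.isMeasuring_Mc _).comp (HAlg.isMeasuring_Mc _),
    fun X => HopfAlgebroid.Hom.isMeasuring (𝟙 X),
    HAlg.enrichedOrdinary 𝒞, fun _ _ => rfl, fun X Y Z => ?_, fun X => ?_, fun X Y g c => ?_⟩⟩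
  · intro C _ _ _ _ Ψ ψ h
    obtain ⟨ξ, h₁, h₂⟩ := HAlg.exists_lift_Mc (K := 𝒞 X Y) h
    exact ⟨ξ, ⟨h₁, h₂⟩, fun ξ' h' =>
      HAlg.Mc_hom_ext (h'.1.trans h₁.symm) (h'.2.trans h₂.symm)⟩
  · refine ⟨TensorProduct.ext' fun x y => ?_, TensorProduct.ext' fun x y => ?_⟩
    · exact HAlg.McTotal_McComp_tmul _ _ _ x y
    · exact HAlg.McBase_McComp_tmul _ _ _ x y
  · exact ⟨LinearMap.ext fun c => HAlg.McTotal_McPoint_apply _ (𝟙 X) c,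
      LinearMap.ext fun c => HAlg.McBase_McPoint_apply _ (𝟙 X) c⟩
  · exact ⟨HAlg.McTotal_McPoint_apply _ g c, HAlg.McBase_McPoint_apply _ g c⟩
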